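/- Let $H$ be a Hilbert space of finite dimension $d\ge 1$. A super-operator on $H$ is a completely positive linear map on $L(H)$; $\mathcal S(H)$ is the set of super-operators and $\mathcal I$ is the identity. For $\mathcal E,\mathcal F\in\mathcal S(H)$ write $\mathcal E\sqsubseteq\mathcal F$ if $\mathcal F(\rho)-\mathcal E(\rho)$ is positive semi-definite for every density operator $\rho$, and $\mathcal E\lesssim\mathcal F$ (or $\mathcal F\gtrsim\mathcal E$) if $\mathrm{tr}\,\mathcal E(\rho)\le\mathrm{tr}\,\mathcal F(\rho)$ for every density operator $\rho$. Let $\mathcal S^1(H)=\{\mathcal E\in\mathcal S(H):\mathcal E\lesssim\mathcal I\}$, and order $\mathcal S^1(H)^n$ componentwise by $\sqsubseteq$. Fix an orthonormal basis $(|a\rangle)$ of $H$. The matrix representation $M_{\mathcal E}$ of $\mathcal E$ is the $d^2\times d^2$ matrix with the entry $\langle a|\mathcal E(|c\rangle\langle c'|)|a'\rangle$ in row $(a,a')$ and column $(c,c')$ (so $M_{\mathcal E}=\sum_k E_k\otimes E_k^*$ for Kraus operators $E_k$ of $\mathcal E$, where $^*$ is the entrywise complex conjugate); $M_{\mathcal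 T}$ and $M_{\widetilde{\mathcal G}}$ are the corresponding block matrices for a matrix $\mathcal T$ and a row $\widetilde{\mathcal G}$ of super-operators. If $M=SJS^{-1}$ is a Jordan decomposition, let $\tilde M=S\tilde JS^{-1}$, where $\tilde J$ arises from $J$ by replacing each Jordan block whose eigenvalue has absolute value at least $1$ by the zero block of the same size. **Theorem.** Let $\mathcal T$ be an $n\times n$ matrix and $\widetilde{\mathcal G}$ a $1\times n$ row of super-operators on $H$ with $\sum_i\mathcal T_{ij}+\widetilde{\mathcal G}_j\lesssim\mathcal I$ for each $j$, and let $f(X)=X\mathcal T+\widetilde{\mathcal G}$, where products of super-operators are compositions. 1. $f$ has a least fixed point $\widetilde{\mathcal E}$ in $(\mathcal S^1(H)^n,\sqsubseteq)$. For every orthonormal basis of $H$ and every Jordan decomposition of $M_{\mathcal T}$, the matrix $I-\tilde M_{\mathcal T}$ is invertible and $M_{\widetilde{\mathcal E}}=M_{\widetilde{\mathcal G}}(I-\tilde M_{\mathcal T})^{-1}$. 2. For each of the two relations $\sim\;\in\{\lesssim,\gtrsim\}$ there is one algorithm which, given $n$, $d$, $\mathcal T$, $\widetilde{\mathcal G}$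 as above, $\mathcal E\in\mathcal S^1(H)$ and $1\le i\le n$, decides whether $\mathcal E\sim\widetilde{\mathcal E}_i$ in time $O(n^2d^4)$, with an absolute constant. Here super-operators are given by the entries of their matrix representations in some orthonormal basis, and the algorithm is a program for a random access machine with exact complex arithmetic: arithmetic operations ($+,-,\times,\div$ and complex conjugation on complex numbers; $+,-,\times$ on addresses and counters), memory accesses, assignments and comparisons (of counters, and of real parts of complex numbers) take one unit of time each, and the machine has a primitive that returns some Jordan decomposition, as a triple $S,J,S^{-1}$, of an $m\times m$ matrix and is charged one unit of time for each of the $m^2$ entries. The algorithm is correct whatever Jordan decompositions the primitive returns. -/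

import Mathlib

open scoped BigOperators

namespace QMC

noncomputable section

/-! ## Super-operators on a finite-dimensional Hilbert space -/

/-- Linear maps on the space `L(H)` of operators of `H`. -/
abbrev OpMap (H : Type*) [NormedAddCommGroup H] [InnerProductSpace ℂ H] : Type _ :=
  (H →ₗ[ℂ] H) →ₗ[ℂ] (H →ₗ[ℂ] H)

section SuperOp

variable {H : Type*} [NormedAddCommGroup H] [InnerProductSpace ℂ H]

/-- Positivity of the operator on `H ⊕ ⋯ ⊕ H = ℂᵏ ⊗ H` with blocks `A p q`:
its quadratic form is real and nonnegative. -/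
def BlockPositive {k : ℕ} (A : Fin k → Fin k → (H →ₗ[ℂ] H)) : Prop :=
  ∀ v : Fin k → H,
    0 ≤ (∑ p, ∑ q, inner ℂ (v p) (A p q (v q))).re ∧
      (∑ p, ∑ q, inner ℂ (v p) (A p q (v q))).im = 0

/-- Complete positivity: every extension `id_k ⊗ E` maps positive operators on `ℂᵏ ⊗ H`
to positive operators. The completely positive maps are the super-operators, `S(H)`. -/
def IsSuperOp (E : OpMap H) : Prop :=
  ∀ (k : ℕ) (A : Fin k → Fin k → (H →ₗ[ℂ] H)),
    BlockPositive A → BlockPositive (fun p q => E (A p q))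

/-- Density operators: positive operators of trace one. -/
def IsDensity (ρ : H →ₗ[ℂ] H) : Prop :=
  ρ.IsPositive ∧ LinearMap.trace ℂ H ρ = 1

/-- `E ⊑ F`: the difference `F ρ - E ρ` is positive semi-definite for each density operator. -/
def LoewnerLE (E F : OpMap H) : Prop :=
  ∀ ρ : H →ₗ[ℂ] H, IsDensity ρ → (F ρ - E ρ).IsPositive

/-- `E ≲ F`: `tr (E ρ) ≤ tr (F ρ)` for each density operator. -/
def TraceLE (E F : OpMap H) : Prop :=
  ∀ ρ : H →ₗ[ℂ] H, IsDensity ρ →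
    (LinearMap.trace ℂ H (E ρ)).re ≤ (LinearMap.trace ℂ H (F ρ)).re

/-- `S¹(H)`: the super-operators `E` with `E ≲ I`. -/
def IsSubOp (E : OpMap H) : Prop :=
  IsSuperOp E ∧ TraceLE E LinearMap.id

/-- The map `f(X) = X T + G` on row vectors; products of super-operators are compositions. -/
def affineMap {n : ℕ} (T : Matrix (Fin n) (Fin n) (OpMap H)) (G X : Fin n → OpMap H) :
    Fin n → OpMap H :=
  fun j => ∑ i, X i ∘ₗ T i j + G j

/-- The standing data: `T` and `G` consist of super-operators and
`∑ i, T i j + G j ≲ I` for each column `j`. -/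
structure IsSystem {n : ℕ} (T : Matrix (Fin n) (Fin n) (OpMap H)) (G : Fin n → OpMap H) :
    Prop where
  superOp_T : ∀ i j, IsSuperOp (T i j)
  superOp_G : ∀ j, IsSuperOp (G j)
  column_le : ∀ j, TraceLE (∑ i, T i j + G j) LinearMap.id

/-- `E` is the least fixed point of `f(X) = X T + G` in `S¹(H)ⁿ`, ordered componentwise
by `⊑`. -/
structure IsLeastFixedPoint {n : ℕ} (T : Matrix (Fin n) (Fin n) (OpMap H))
    (G E : Fin n → OpMap H) : Prop where
  mem : ∀ j, IsSubOp (E j)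
  fixed : affineMap T G E = E
  least : ∀ X : Fin n → OpMap H, (∀ j, IsSubOp (X j)) → affineMap T G X = X →
    ∀ j, LoewnerLE (E j) (X j)

/-! ## Matrix representations -/

/-- The matrix representation `M_E` with respect to an orthonormal basis `b`. Its entry in row
`(a, a')` and column `(c, c')` is `⟨a| E(|c⟩⟨c'|) |a'⟩`. -/
def matrixRep {d : ℕ} (b : OrthonormalBasis (Fin d) ℂ H) (E : OpMap H) :
    Matrix (Fin d × Fin d) (Fin d × Fin d) ℂ :=
  fun r s => inner ℂ (b r.1) (E (InnerProductSpace.rankOne ℂ (b s.1) (b s.2) : H →ₗ[ℂ] H) (b r.2))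

/-- If `E` has Kraus operators `K i`, then `M_E = ∑ i, K i ⊗ (K i)^*`, where `*` is the entrywise
complex conjugate. -/
theorem matrixRep_kraus [FiniteDimensional ℂ H] {d : ℕ} (b : OrthonormalBasis (Fin d) ℂ H)
    {ι : Type*} [Fintype ι] (K : ι → (H →ₗ[ℂ] H)) (E : OpMap H)
    (hE : ∀ A, E A = ∑ i, K i ∘ₗ A ∘ₗ LinearMap.adjoint (K i)) :
    matrixRep b E = ∑ i, Matrix.kroneckerMap (fun x y => x * y)
      (LinearMap.toMatrix b.toBasis b.toBasis (K i))
      ((LinearMap.toMatrix b.toBasis b.toBasis (K i)).map star) := by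
  ext r s
  simp only [matrixRep, hE, Matrix.sum_apply, LinearMap.sum_apply, inner_sum]
  refine Finset.sum_congr rfl fun i _ => ?_
  simp only [LinearMap.comp_apply, ContinuousLinearMap.coe_coe,
    InnerProductSpace.rankOne_apply, map_smul, inner_smul_right, Matrix.kroneckerMap_apply,
    Matrix.map_apply, LinearMap.toMatrix_apply, OrthonormalBasis.coe_toBasis,
    OrthonormalBasis.coe_toBasis_repr_apply, OrthonormalBasis.repr_apply_apply,
    LinearMap.adjoint_inner_right]
  rw [mul_comm, RCLike.star_def, inner_conj_symm]

/-- The block matrix `M_T` of a square matrix of super-operators. -/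
def matrixRepSquare {d n : ℕ} (b : OrthonormalBasis (Fin d) ℂ H)
    (T : Matrix (Fin n) (Fin n) (OpMap H)) :
    Matrix (Fin n × Fin d × Fin d) (Fin n × Fin d × Fin d) ℂ :=
  fun r s => matrixRep b (T r.1 s.1) r.2 s.2

/-- The block matrix `M_G` of a row vector of super-operators. -/
def matrixRepRow {d n : ℕ} (b : OrthonormalBasis (Fin d) ℂ H) (G : Fin n → OpMap H) :
    Matrix (Fin d × Fin d) (Fin n × Fin d × Fin d) ℂ :=
  fun r s => matrixRep b (G s.1) r s.2

end SuperOp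

/-! ## Jordan decompositions -/

/-- `J` is a block diagonal matrix of (upper) Jordan blocks: all entries off the diagonal and the
superdiagonal vanish, each superdiagonal entry is `0` (two blocks meet) or `1` (inside a block),
and the diagonal is constant along each block. -/
def IsJordanForm {m : ℕ} (J : Matrix (Fin m) (Fin m) ℂ) : Prop :=
  (∀ p q : Fin m, q ≠ p → (q : ℕ) ≠ p + 1 → J p q = 0) ∧
    ∀ p q : Fin m, (q : ℕ) = p + 1 → J p q = 0 ∨ (J p q = 1 ∧ J p p = J q q)

/-- `M = S J S⁻¹` is a Jordan decomposition, with inverse `S' = S⁻¹`. -/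
structure IsJordanDecomp {ι : Type*} [Fintype ι] [DecidableEq ι] {m : ℕ}
    (M : Matrix ι ι ℂ) (S : Matrix ι (Fin m) ℂ) (J : Matrix (Fin m) (Fin m) ℂ)
    (S' : Matrix (Fin m) ι ℂ) : Prop where
  mul_inv : S * S' = 1
  inv_mul : S' * S = 1
  jordan : IsJordanForm J
  eq : M = S * J * S'

/-- `J` with each Jordan block whose eigenvalue has absolute value at least `1` replaced by the
zero block. -/
def truncate {m : ℕ} (J : Matrix (Fin m) (Fin m) ℂ) : Matrix (Fin m) (Fin m) ℂ :=
  open Classical in fun p q => if 1 ≤ ‖J p p‖ then 0 else J p q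

/-! ## A random access machine with exact complex arithmetic

Programs work on registers for natural numbers and on arrays of complex numbers. Each arithmetic
operation, comparison, memory access and assignment takes one unit of time. A further primitive
computes a Jordan decomposition of an `m × m` matrix in a time of one unit per matrix entry. -/

/-- Expressions for natural numbers (used for addresses and counters). -/
inductive NExpr : Type
  | const (k : ℕ)
  | reg (r : ℕ)
  | add (e f : NExpr)
  | sub (e f : NExpr)
  | mul (e f : NExpr)

/-- Expressions for complex numbers; `cell a e` is the content of array `a` at the address `e`. -/
inductive CExpr : Type
  | zero
  | one
  | cell (a : ℕ) (e : NExpr)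
  | add (x y : CExpr)
  | sub (x y : CExpr)
  | mul (x y : CExpr)
  | div (x y : CExpr)
  | conj (x : CExpr)

/-- Tests: comparison of natural numbers, comparison of real parts of complex numbers. -/
inductive Test : Type
  | lt (e f : NExpr)
  | reLE (x y : CExpr)

/-- Programs. -/
inductive Program : Type
  | skip
  | setReg (r : ℕ) (e : NExpr)
  | setCell (a : ℕ) (e : NExpr) (x : CExpr)
  | jordan (m : NExpr) (aM aS aJ aS' : ℕ)
  | seq (P Q : Program)
  | branch (t : Test) (P Q : Program)
  | loop (t : Test) (P : Program)

/-- Memory contents. -/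
structure State : Type where
  reg : ℕ → ℕ
  mem : ℕ → ℕ → ℂ

def NExpr.eval (s : State) : NExpr → ℕ
  | const k => k
  | reg r => s.reg r
  | add e f => e.eval s + f.eval s
  | sub e f => e.eval s - f.eval s
  | mul e f => e.eval s * f.eval s

def NExpr.cost : NExpr → ℕ
  | const _ => 1
  | reg _ => 1
  | add e f => e.cost + f.cost + 1
  | sub e f => e.cost + f.cost + 1
  | mul e f => e.cost + f.cost + 1

def CExpr.eval (s : State) : CExpr → ℂ
  | zero => 0
  | one => 1
  | cell a e => s.mem a (e.eval s)
  | add x y => x.eval s + y.eval s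
  | sub x y => x.eval s - y.eval s
  | mul x y => x.eval s * y.eval s
  | div x y => x.eval s / y.eval s
  | conj x => star (x.eval s)

def CExpr.cost : CExpr → ℕ
  | zero => 1
  | one => 1
  | cell _ e => e.cost + 1
  | add x y => x.cost + y.cost + 1
  | sub x y => x.cost + y.cost + 1
  | mul x y => x.cost + y.cost + 1
  | div x y => x.cost + y.cost + 1
  | conj x => x.cost + 1

def Test.Holds (s : State) : Test → Prop
  | lt e f => e.eval s < f.eval s
  | reLE x y => (x.eval s).re ≤ (y.eval s).re

def Test.cost : Test → ℕ
  | lt e f => e.cost + f.cost + 1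
  | reLE x y => x.cost + y.cost + 1

def State.setReg (s : State) (r k : ℕ) : State :=
  { s with reg := Function.update s.reg r k }

def State.setCell (s : State) (a k : ℕ) (z : ℂ) : State :=
  { s with mem := Function.update s.mem a (Function.update (s.mem a) k z) }

/-- The `m × m` matrix stored row by row in array `a`. -/
def State.readMatrix (s : State) (a m : ℕ) : Matrix (Fin m) (Fin m) ℂ :=
  fun p q => s.mem a (p * m + q)

/-- Store an `m × m` matrix row by row in the first `m * m` cells of array `a`. -/
def State.writeMatrix (s : State) (a : ℕ) {m : ℕ} (M : Matrix (Fin m) (Fin m) ℂ) : State :=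
  { s with
    mem := Function.update s.mem a fun k =>
      if h : k < m * m then
        M ⟨k / m, Nat.div_lt_of_lt_mul h⟩
          ⟨k % m, Nat.mod_lt _ (Nat.pos_of_ne_zero fun h0 => by simp [h0] at h)⟩
      else s.mem a k }

/-- A possible behaviour of the primitive for Jordan decompositions: it returns some Jordan
decomposition `M = S J S⁻¹` of its input `M`, as a triple `S`, `J`, `S⁻¹`, whenever `M` has one.
(The decomposition is not unique; algorithms have to work for each choice.) -/
structure JordanSubroutine : Type where
  left : ∀ {m : ℕ}, Matrix (Fin m) (Fin m) ℂ → Matrix (Fin m) (Fin m) ℂ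
  form : ∀ {m : ℕ}, Matrix (Fin m) (Fin m) ℂ → Matrix (Fin m) (Fin m) ℂ
  right : ∀ {m : ℕ}, Matrix (Fin m) (Fin m) ℂ → Matrix (Fin m) (Fin m) ℂ
  spec : ∀ {m : ℕ} (M : Matrix (Fin m) (Fin m) ℂ),
    (∃ S J S' : Matrix (Fin m) (Fin m) ℂ, IsJordanDecomp M S J S') →
      IsJordanDecomp M (left M) (form M) (right M)

/-- `Run O P s s' t`: started in `s`, the program `P` halts in `s'` after time `t`. -/
inductive Run (O : JordanSubroutine) : Program → State → State → ℕ → Prop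
  | skip (s : State) : Run O .skip s s 1
  | setReg (s : State) (r : ℕ) (e : NExpr) :
      Run O (.setReg r e) s (s.setReg r (e.eval s)) (e.cost + 1)
  | setCell (s : State) (a : ℕ) (e : NExpr) (x : CExpr) :
      Run O (.setCell a e x) s (s.setCell a (e.eval s) (x.eval s)) (e.cost + x.cost + 1)
  | jordan (s : State) (m : NExpr) (aM aS aJ aS' : ℕ)
      (M : Matrix (Fin (m.eval s)) (Fin (m.eval s)) ℂ) (hM : M = s.readMatrix aM (m.eval s)) :
      Run O (.jordan m aM aS aJ aS') s
        (((s.writeMatrix aS (O.left M)).writeMatrix aJ (O.form M)).writeMatrix aS' (O.right M))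
        (m.cost + m.eval s * m.eval s + 1)
  | seq {P Q : Program} {s s₁ s₂ : State} {t₁ t₂ : ℕ} (hP : Run O P s s₁ t₁)
      (hQ : Run O Q s₁ s₂ t₂) : Run O (.seq P Q) s s₂ (t₁ + t₂)
  | branch_true {c : Test} {P Q : Program} {s s₁ : State} {t : ℕ} (hc : c.Holds s)
      (hP : Run O P s s₁ t) : Run O (.branch c P Q) s s₁ (c.cost + t)
  | branch_false {c : Test} {P Q : Program} {s s₁ : State} {t : ℕ} (hc : ¬ c.Holds s)
      (hQ : Run O Q s s₁ t) : Run O (.branch c P Q) s s₁ (c.cost + t)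
  | loop_true {c : Test} {P : Program} {s s₁ s₂ : State} {t₁ t₂ : ℕ} (hc : c.Holds s)
      (hP : Run O P s s₁ t₁) (hL : Run O (.loop c P) s₁ s₂ t₂) :
      Run O (.loop c P) s s₂ (c.cost + t₁ + t₂)
  | loop_false {c : Test} {P : Program} {s : State} (hc : ¬ c.Holds s) :
      Run O (.loop c P) s s c.cost

section Input

variable {H : Type*} [NormedAddCommGroup H] [InnerProductSpace ℂ H]

/-- The position of `(a, a')` in the lexicographic enumeration of pairs. -/
def pairIndex {d : ℕ} (r : Fin d × Fin d) : ℕ := r.1 * d + r.2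

/-- The position of `(i, a, a')` in the lexicographic enumeration of triples. -/
def tripleIndex {n d : ℕ} (r : Fin n × Fin d × Fin d) : ℕ := r.1 * (d * d) + pairIndex r.2

/-- The memory `s` contains the problem instance: the numbers `n`, `d`, `i` in the registers
`0`, `1`, `2` and the matrix representations of `T`, `G` and `E`, row by row, in the arrays
`0`, `1`, `2`. Nothing is assumed on the remaining memory. -/
structure IsInput {n d : ℕ} (b : OrthonormalBasis (Fin d) ℂ H)
    (T : Matrix (Fin n) (Fin n) (OpMap H)) (G : Fin n → OpMap H) (E : OpMap H) (i : Fin n)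
    (s : State) : Prop where
  reg_n : s.reg 0 = n
  reg_d : s.reg 1 = d
  reg_i : s.reg 2 = i
  mem_T : ∀ r c, s.mem 0 (tripleIndex r * (n * (d * d)) + tripleIndex c) = matrixRepSquare b T r c
  mem_G : ∀ r c, s.mem 1 (pairIndex r * (n * (d * d)) + tripleIndex c) = matrixRepRow b G r c
  mem_E : ∀ r c, s.mem 2 (pairIndex r * (d * d) + pairIndex c) = matrixRep b E r c

end Input

/-- Started in `s`, the program halts within time `t` and its answer, in register `0`, is
`1` (yes) if `A` holds and `0` (no) otherwise. -/
def Decides (O : JordanSubroutine) (P : Program) (s : State) (t : ℕ) (A : Prop) : Prop :=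
  ∃ (s' : State) (t' : ℕ), Run O P s s' t' ∧ t' ≤ t ∧
    (A → s'.reg 0 = 1) ∧ (¬ A → s'.reg 0 = 0)

end

end QMC

namespace QMC

noncomputable section

/-! ### Positive operators, traces and super-operators. -/

section Positive

open Filter Topology ComplexOrder

variable {H : Type*} [NormedAddCommGroup H] [InnerProductSpace ℂ H]

/-! Iterating `f` from `0` gives an increasing sequence of tuples of super-operators, and the column
condition keeps their traces bounded. Such a sequence converges pointwise (`exists_tendstoOp`).
Complete positivity and the trace bound are closed conditions, so they survive in the limit, which
is a fixed point and lies below every other one.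

In matrix form the iteration is `z ↦ z M_T + M_G`. As it converges, its increments `M_G M_T ^ k`
tend to `0`. A row vector whose orbit under a Jordan form tends to `0` has no component in the
blocks with `|λ| ≥ 1` (`IsJordanForm.eq_zero_of_tendsto`), hence neither has the limit. Deleting
these blocks therefore does not change the fixed point equation, while it makes `1 - J` after
truncation triangular with nonzero diagonal. Solving for the limit gives the formula
(`IsLeastFixedPoint.matrixRepRow_eq`).

For the decision problem, put `m = n d²`. Inverting or multiplying `m × m` matrices would exceed the
time `m² = n² d⁴`. But `≲` only involves the numbers `tr F_i(|c⟩⟨c'|)`, a part of the single row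
vector obtained by applying the trace functional to `M_F`. One row vector passes through `S` and
`S⁻¹` in time `O(m²)`, and in between the bidiagonal system for `J` is solved by substitution in
time `O(m)`. Then `E ≲ F` means that a Hermitian `d × d` matrix is positive semidefinite
(`traceLE_iff_posSemidef`). The primitive settles this as well, because the diagonal of a Jordan
form lists the eigenvalues. Since the primitive is only constrained on matrices that have a Jordan
decomposition, the existence of one is proved for every complex matrix (`exists_jordanDecomp`), from
the structure theorem for torsion modules over `ℂ[X]`. -/

theorem isPositive_iff_inner (A : H →ₗ[ℂ] H) :
    A.IsPositive ↔ ∀ v, 0 ≤ (inner ℂ v (A v) : ℂ).re ∧ (inner ℂ v (A v) : ℂ).im = 0 := by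
  rw [LinearMap.isPositive_iff_complex]
  refine forall_congr' fun v => ?_
  rw [← inner_conj_symm v (A v)]
  simp only [Complex.ext_iff, RCLike.re_to_complex, Complex.ofReal_re, Complex.ofReal_im,
    Complex.conj_re, Complex.conj_im, true_and]
  constructor
  · rintro ⟨h1, h2⟩
    exact ⟨h2, by rw [← h1]; simp⟩
  · rintro ⟨h1, h2⟩
    exact ⟨by linarith, h1⟩

theorem blockPositive_fin_one (A : H →ₗ[ℂ] H) :
    BlockPositive (k := 1) (fun _ _ => A) ↔ A.IsPositive := by
  rw [isPositive_iff_inner]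
  simp only [BlockPositive, Finset.univ_unique, Finset.sum_singleton]
  exact ⟨fun h v => h fun _ => v, fun h v => h _⟩

theorem IsSuperOp.isPositive {E : OpMap H} (hE : IsSuperOp E) {ρ : H →ₗ[ℂ] H}
    (hρ : ρ.IsPositive) : (E ρ).IsPositive :=
  (blockPositive_fin_one _).1 (hE 1 _ ((blockPositive_fin_one _).2 hρ))

theorem IsSuperOp.zero : IsSuperOp (0 : OpMap H) := fun k A _ v => by simp

theorem IsSuperOp.add {E F : OpMap H} (hE : IsSuperOp E) (hF : IsSuperOp F) :
    IsSuperOp (E + F) := fun k A hA v => by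
  have h1 := hE k A hA v
  have h2 := hF k A hA v
  simp only [LinearMap.add_apply, inner_add_right, Finset.sum_add_distrib, Complex.add_re,
    Complex.add_im] at *
  exact ⟨add_nonneg h1.1 h2.1, by rw [h1.2, h2.2, add_zero]⟩

theorem IsSuperOp.sum {ι : Type*} (s : Finset ι) {E : ι → OpMap H}
    (hE : ∀ i ∈ s, IsSuperOp (E i)) : IsSuperOp (∑ i ∈ s, E i) :=
  Finset.sum_induction _ _ (fun _ _ => IsSuperOp.add) IsSuperOp.zero hE

theorem IsSuperOp.comp {E F : OpMap H} (hE : IsSuperOp E) (hF : IsSuperOp F) :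
    IsSuperOp (E ∘ₗ F) := fun k _ hA => hE k _ (hF k _ hA)

/-- A unit vector extends to an orthonormal basis, and the trace is the sum of the nonnegative
diagonal entries in that basis. Trace bounds thereby control all quadratic forms of a positive
operator. -/
theorem inner_nonneg_le_trace [FiniteDimensional ℂ H] {P : H →ₗ[ℂ] H} (hP : P.IsPositive)
    (v : H) : (inner ℂ v (P v) : ℂ).re ≤ (LinearMap.trace ℂ H P).re * ‖v‖ ^ 2 := by
  rcases eq_or_ne v 0 with rfl | hv
  · simp
  have hv' : ‖v‖ ≠ 0 := norm_ne_zero_iff.2 hv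
  set w : H := ((‖v‖⁻¹ : ℝ) : ℂ) • v with hw
  have hwn : ‖w‖ = 1 := by
    rw [hw, norm_smul, Complex.norm_real, norm_inv, norm_norm, inv_mul_cancel₀ hv']
  have hvw : v = ((‖v‖ : ℝ) : ℂ) • w := by
    rw [hw, smul_smul, ← Complex.ofReal_mul, mul_inv_cancel₀ hv', Complex.ofReal_one, one_smul]
  have ho : Orthonormal ℂ ((↑) : ({w} : Set H) → H) := by
    constructor
    · rintro ⟨x, rfl⟩
      exact hwn
    · rintro ⟨x, rfl⟩ ⟨y, rfl⟩ h
      exact absurd rfl h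
  obtain ⟨u, b, hu, hb⟩ := ho.exists_orthonormalBasis_extension
  have hwu : w ∈ u := hu rfl
  have h1 : (inner ℂ w (P w) : ℂ).re ≤ (LinearMap.trace ℂ H P).re := by
    rw [LinearMap.trace_eq_sum_inner P b, Complex.re_sum]
    have := Finset.single_le_sum (f := fun i => (inner ℂ (b i) (P (b i)) : ℂ).re)
      (fun i _ => ((isPositive_iff_inner P).1 hP (b i)).1) (Finset.mem_univ ⟨w, hwu⟩)
    simpa [hb] using this
  have h2 : (inner ℂ v (P v) : ℂ) = ((‖v‖ ^ 2 : ℝ) : ℂ) * inner ℂ w (P w) := by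
    conv_lhs => rw [hvw]
    rw [map_smul, inner_smul_left, inner_smul_right, Complex.conj_ofReal]
    push_cast
    ring
  rw [h2, Complex.re_ofReal_mul, mul_comm]
  exact mul_le_mul_of_nonneg_right h1 (sq_nonneg _)

theorem IsPositive.trace_re_nonneg [FiniteDimensional ℂ H] {P : H →ₗ[ℂ] H}
    (hP : P.IsPositive) : 0 ≤ (LinearMap.trace ℂ H P).re :=
  (Complex.nonneg_iff.1 hP.trace_nonneg).1

theorem IsPositive.ofReal_trace_re [FiniteDimensional ℂ H] {P : H →ₗ[ℂ] H}
    (hP : P.IsPositive) : (((LinearMap.trace ℂ H P).re : ℝ) : ℂ) = LinearMap.trace ℂ H P :=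
  Complex.ext rfl (Complex.nonneg_iff.1 hP.trace_nonneg).2

theorem IsPositive.eq_zero_of_trace [FiniteDimensional ℂ H] {P : H →ₗ[ℂ] H}
    (hP : P.IsPositive) (h : (LinearMap.trace ℂ H P).re = 0) : P = 0 := by
  rw [← hP.isSymmetric.inner_map_self_eq_zero]
  intro v
  have h1 := inner_nonneg_le_trace hP v
  have h2 := (isPositive_iff_inner P).1 hP v
  rw [h, zero_mul] at h1
  rw [← inner_conj_symm, map_eq_zero]
  exact Complex.ext (le_antisymm h1 h2.1) h2.2

/-- Every positive operator is a nonnegative multiple of a density operator, or zero. -/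
theorem IsPositive.eq_smul_density [FiniteDimensional ℂ H] {P : H →ₗ[ℂ] H}
    (hP : P.IsPositive) :
    P = 0 ∨ ∃ (t : ℝ) (ρ : H →ₗ[ℂ] H), 0 ≤ t ∧ IsDensity ρ ∧ P = (t : ℂ) • ρ := by
  rcases eq_or_ne (LinearMap.trace ℂ H P).re 0 with h | h
  · exact Or.inl (IsPositive.eq_zero_of_trace hP h)
  right
  have h0 := IsPositive.trace_re_nonneg hP
  set t := (LinearMap.trace ℂ H P).re with ht
  have htc : (t : ℂ) ≠ 0 := Complex.ofReal_ne_zero.2 h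
  refine ⟨t, ((t⁻¹ : ℝ) : ℂ) • P, h0, ⟨hP.smul_of_nonneg ?_, ?_⟩, ?_⟩
  · exact Complex.zero_le_real.2 (inv_nonneg.2 h0)
  · rw [map_smul, ← IsPositive.ofReal_trace_re hP, ← ht, smul_eq_mul, Complex.ofReal_inv,
      inv_mul_cancel₀ htc]
  · rw [smul_smul, Complex.ofReal_inv, mul_inv_cancel₀ htc, one_smul]

theorem TraceLE.apply_positive [FiniteDimensional ℂ H] {E F : OpMap H} (h : TraceLE E F)
    {P : H →ₗ[ℂ] H} (hP : P.IsPositive) :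
    (LinearMap.trace ℂ H (E P)).re ≤ (LinearMap.trace ℂ H (F P)).re := by
  rcases IsPositive.eq_smul_density hP with rfl | ⟨t, ρ, ht, hρ, rfl⟩
  · simp
  · simp only [map_smul, smul_eq_mul, Complex.re_ofReal_mul]
    exact mul_le_mul_of_nonneg_left (h ρ hρ) ht

theorem LoewnerLE.apply_positive [FiniteDimensional ℂ H] {E F : OpMap H} (h : LoewnerLE E F)
    {P : H →ₗ[ℂ] H} (hP : P.IsPositive) : (F P - E P).IsPositive := by
  rcases IsPositive.eq_smul_density hP with rfl | ⟨t, ρ, ht, hρ, rfl⟩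
  · simp
  · rw [map_smul, map_smul, ← smul_sub]
    exact (h ρ hρ).smul_of_nonneg (Complex.zero_le_real.2 ht)

/-- Every operator is a linear combination of four positive operators. -/
theorem exists_positive_decomposition [FiniteDimensional ℂ H] (A : H →ₗ[ℂ] H) :
    ∃ (c : Fin 4 → ℂ) (P : Fin 4 → (H →ₗ[ℂ] H)),
      (∀ i, (P i).IsPositive) ∧ A = ∑ i, c i • P i := by
  -- Polarization with `S_k = A + iᵏ`: in the sum of `iᵏ S_k S_k^*` over `k < 4`, everything cancels
  -- except `4 A`.
  let S : Fin 4 → (H →ₗ[ℂ] H) := fun i => A + (Complex.I ^ (i : ℕ)) • LinearMap.id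
  refine ⟨fun i => Complex.I ^ (i : ℕ) / 4, fun i => S i ∘ₗ LinearMap.adjoint (S i),
    fun i => LinearMap.isPositive_self_comp_adjoint _, ?_⟩
  have hid : LinearMap.adjoint (LinearMap.id : H →ₗ[ℂ] H) = LinearMap.id :=
    LinearMap.adjoint_id
  ext v
  have hI := Complex.I_sq
  simp only [S, Fin.sum_univ_four, LinearMap.add_apply, LinearMap.smul_apply,
    LinearMap.comp_apply, map_add, LinearEquiv.map_smulₛₗ, hid, LinearMap.id_apply, map_smul,
    map_pow, Complex.conj_I, smul_add, smul_smul]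
  have h3 : Complex.I ^ 3 = -Complex.I := by rw [pow_succ, hI]; ring
  simp only [Fin.val_zero, Fin.val_one, Fin.val_two, show ((3 : Fin 4) : ℕ) = 3 from rfl, pow_zero,
    pow_one, neg_pow Complex.I, hI, h3]
  match_scalars <;> ring_nf <;> simp only [hI] <;> ring

end Positive

/-! ### Kleene iteration and the least fixed point. -/

section FixedPoint

open Filter Topology ComplexOrder

variable {H : Type*} [NormedAddCommGroup H] [InnerProductSpace ℂ H]

/-- Pointwise convergence of linear maps on operators. -/
def TendstoOp (X : ℕ → OpMap H) (F : OpMap H) : Prop :=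
  ∀ A v, Tendsto (fun k => X k A v) atTop (𝓝 (F A v))

/-- The quadratic forms of `X k P` are nondecreasing in `k` and bounded through the trace, so they
converge. Polarization gives convergence of all inner products, hence of all coordinates. -/
theorem exists_tendsto_of_positive [FiniteDimensional ℂ H] {X : ℕ → OpMap H}
    (hX : ∀ k, IsSuperOp (X k))
    {P : H →ₗ[ℂ] H} (hP : P.IsPositive) (hmono : ∀ k, (X (k + 1) P - X k P).IsPositive) (C : ℝ)
    (hC : ∀ k, (LinearMap.trace ℂ H (X k P)).re ≤ C) (v : H) :
    ∃ w, Tendsto (fun k => X k P v) atTop (𝓝 w) := by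
  have hpos := fun k v => (isPositive_iff_inner _).1 ((hX k).isPositive hP) v
  have hquad : ∀ u : H, ∃ z : ℂ, Tendsto (fun k => (inner ℂ (X k P u) u : ℂ)) atTop (𝓝 z) := by
    intro u
    have hm : Monotone fun k => (inner ℂ u (X k P u) : ℂ).re := by
      refine monotone_nat_of_le_succ fun k => ?_
      have := ((isPositive_iff_inner _).1 (hmono k) u).1
      rwa [LinearMap.sub_apply, inner_sub_right, Complex.sub_re, sub_nonneg] at this
    have hb : BddAbove (Set.range fun k => (inner ℂ u (X k P u) : ℂ).re) := by
      refine ⟨C * ‖u‖ ^ 2, ?_⟩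
      rintro _ ⟨k, rfl⟩
      exact (inner_nonneg_le_trace ((hX k).isPositive hP) u).trans
        (mul_le_mul_of_nonneg_right (hC k) (sq_nonneg _))
    have ht := tendsto_atTop_ciSup hm hb
    refine ⟨_, ((Complex.continuous_ofReal.tendsto _).comp ht).congr fun k => ?_⟩
    rw [← inner_conj_symm (X k P u) u]
    exact Complex.ext rfl ((Complex.ofReal_im _).trans
      (by rw [Complex.conj_im, (hpos k u).2, neg_zero]))
  have hpol : ∀ x : H, ∃ z : ℂ, Tendsto (fun k => (inner ℂ (X k P v) x : ℂ)) atTop (𝓝 z) := by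
    intro x
    obtain ⟨z₁, h₁⟩ := hquad (x + v)
    obtain ⟨z₂, h₂⟩ := hquad (x - v)
    obtain ⟨z₃, h₃⟩ := hquad (x + Complex.I • v)
    obtain ⟨z₄, h₄⟩ := hquad (x - Complex.I • v)
    refine ⟨_, ((((h₁.sub h₂).add (h₃.const_mul Complex.I)).sub
      (h₄.const_mul Complex.I)).div_const 4).congr fun k => ?_⟩
    rw [← inner_map_polarization]
  choose z hz using hpol
  let b := stdOrthonormalBasis ℂ H
  refine ⟨∑ i, star (z (b i)) • b i, ?_⟩
  refine (tendsto_finsetSum _ fun i _ => ((hz (b i)).star.smul_const (b i))).congr fun k => ?_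
  conv_rhs => rw [← b.sum_repr' (X k P v)]
  refine Finset.sum_congr rfl fun i _ => ?_
  rw [RCLike.star_def, inner_conj_symm]

/-- A sequence of super-operators which is increasing and bounded in trace converges. -/
theorem exists_tendstoOp [FiniteDimensional ℂ H] {X : ℕ → OpMap H} (hX : ∀ k, IsSuperOp (X k))
    (hmono : ∀ k (P : H →ₗ[ℂ] H), P.IsPositive → (X (k + 1) P - X k P).IsPositive)
    (hC : ∀ k, TraceLE (X k) LinearMap.id) : ∃ F, TendstoOp X F := by
  have hconv : ∀ A v, ∃ w, Tendsto (fun k => X k A v) atTop (𝓝 w) := by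
    intro A v
    -- Monotonicity says something only at positive operators; linearity carries convergence to all
    -- operators.
    obtain ⟨c, P, hP, rfl⟩ := exists_positive_decomposition A
    choose w hw using fun i => exists_tendsto_of_positive hX (hP i) (fun k => hmono k _ (hP i)) _
      (fun k => (hC k).apply_positive (hP i)) v
    refine ⟨∑ i, c i • w i, (tendsto_finsetSum _ fun i _ => (hw i).const_smul (c i)).congr
      fun k => ?_⟩
    simp only [map_sum, map_smul, LinearMap.sum_apply, LinearMap.smul_apply]
  choose w hw using hconv
  refine ⟨
    { toFun := fun A =>
        { toFun := w A
          map_add' := fun v v' => tendsto_nhds_unique (hw A (v + v'))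
            (((hw A v).add (hw A v')).congr fun k => by simp)
          map_smul' := fun c v => tendsto_nhds_unique (hw A (c • v))
            (((hw A v).const_smul c).congr fun k => by simp) }
      map_add' := fun A A' => LinearMap.ext fun v => tendsto_nhds_unique (hw (A + A') v)
        (((hw A v).add (hw A' v)).congr fun k => by simp)
      map_smul' := fun c A => LinearMap.ext fun v => tendsto_nhds_unique (hw (c • A) v)
        (((hw A v).const_smul c).congr fun k => by simp) }, hw⟩

theorem TendstoOp.unique {X : ℕ → OpMap H} {F F' : OpMap H} (h : TendstoOp X F)
    (h' : TendstoOp X F') : F = F' :=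
  LinearMap.ext fun A => LinearMap.ext fun v => tendsto_nhds_unique (h A v) (h' A v)

theorem TendstoOp.isSuperOp {X : ℕ → OpMap H} {F : OpMap H} (h : TendstoOp X F)
    (hX : ∀ k, IsSuperOp (X k)) : IsSuperOp F := by
  intro k A hA v
  have ht : Tendsto (fun m => ∑ p, ∑ q, (inner ℂ (v p) (X m (A p q) (v q)) : ℂ)) atTop
      (𝓝 (∑ p, ∑ q, inner ℂ (v p) (F (A p q) (v q)))) :=
    tendsto_finsetSum _ fun p _ => tendsto_finsetSum _ fun q _ =>
      tendsto_const_nhds.inner (h _ _)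
  exact ⟨ge_of_tendsto' ((Complex.continuous_re.tendsto _).comp ht) fun m => (hX m k A hA v).1,
    tendsto_nhds_unique ((Complex.continuous_im.tendsto _).comp ht)
      (tendsto_const_nhds.congr fun m => (hX m k A hA v).2.symm)⟩

theorem TendstoOp.trace [FiniteDimensional ℂ H] {X : ℕ → OpMap H} {F : OpMap H} (h : TendstoOp X F)
    (A : H →ₗ[ℂ] H) :
    Tendsto (fun k => LinearMap.trace ℂ H (X k A)) atTop (𝓝 (LinearMap.trace ℂ H (F A))) := by
  simp only [LinearMap.trace_eq_sum_inner _ (stdOrthonormalBasis ℂ H)]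
  exact tendsto_finsetSum _ fun i _ => tendsto_const_nhds.inner (h _ _)

theorem TendstoOp.traceLE [FiniteDimensional ℂ H] {X : ℕ → OpMap H} {F E : OpMap H}
    (h : TendstoOp X F) (hX : ∀ k, TraceLE (X k) E) : TraceLE F E := fun ρ hρ =>
  le_of_tendsto' ((Complex.continuous_re.tendsto _).comp (h.trace ρ)) fun k => hX k ρ hρ

theorem TendstoOp.matrixRep {X : ℕ → OpMap H} {F : OpMap H} (h : TendstoOp X F) {d : ℕ}
    (b : OrthonormalBasis (Fin d) ℂ H) (r s : Fin d × Fin d) :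
    Tendsto (fun k => matrixRep b (X k) r s) atTop (𝓝 (matrixRep b F r s)) :=
  tendsto_const_nhds.inner (h _ _)

variable {n : ℕ} {T : Matrix (Fin n) (Fin n) (OpMap H)} {G : Fin n → OpMap H}

/-- The Kleene approximations of the least fixed point of `f(X) = X T + G`. -/
def approx (T : Matrix (Fin n) (Fin n) (OpMap H)) (G : Fin n → OpMap H) : ℕ → Fin n → OpMap H
  | 0 => 0
  | k + 1 => affineMap T G (approx T G k)

theorem IsSystem.approx_isSuperOp (h : IsSystem T G) (k : ℕ) (j : Fin n) :
    IsSuperOp (approx T G k j) := by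
  induction k generalizing j with
  | zero => exact IsSuperOp.zero
  | succ k ih =>
    exact (IsSuperOp.sum _ fun i _ => (ih i).comp (h.superOp_T i j)).add (h.superOp_G j)

/-- By induction `tr X_i(T_ij ρ) ≤ tr T_ij ρ`, so the trace of the next iterate is at most that of
the column sum, which is `≲ I`. -/
theorem IsSystem.approx_traceLE [FiniteDimensional ℂ H] (h : IsSystem T G) (k : ℕ) (j : Fin n) :
    TraceLE (approx T G k j) LinearMap.id := by
  induction k generalizing j with
  | zero =>
    intro ρ hρ
    simpa [approx] using IsPositive.trace_re_nonneg hρ.1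
  | succ k ih =>
    intro ρ hρ
    refine le_trans ?_ (h.column_le j ρ hρ)
    simp only [approx, affineMap, LinearMap.add_apply, LinearMap.sum_apply, LinearMap.comp_apply,
      map_add, map_sum, Complex.add_re, Complex.re_sum]
    exact add_le_add (Finset.sum_le_sum fun i _ =>
      (ih i).apply_positive ((h.superOp_T i j).isPositive hρ.1)) le_rfl

theorem IsSystem.affineMap_mono (h : IsSystem T G) {X Y : Fin n → OpMap H}
    (hXY : ∀ i (P : H →ₗ[ℂ] H), P.IsPositive → (Y i P - X i P).IsPositive) (j : Fin n)
    {P : H →ₗ[ℂ] H} (hP : P.IsPositive) :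
    (affineMap T G Y j P - affineMap T G X j P).IsPositive := by
  have : affineMap T G Y j P - affineMap T G X j P = ∑ i, (Y i (T i j P) - X i (T i j P)) := by
    simp [affineMap, LinearMap.sum_apply]
  rw [this]
  exact LinearMap.isPositive_sum _ fun i _ => hXY i _ ((h.superOp_T i j).isPositive hP)

theorem IsSystem.approx_mono (h : IsSystem T G) (k : ℕ) (j : Fin n) {P : H →ₗ[ℂ] H}
    (hP : P.IsPositive) : (approx T G (k + 1) j P - approx T G k j P).IsPositive := by
  induction k generalizing j P with
  | zero =>
    simpa [approx] using (h.approx_isSuperOp 1 j).isPositive hP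
  | succ k ih => exact h.affineMap_mono (fun i P hP => ih i hP) j hP

theorem IsSystem.approx_le (h : IsSystem T G) {X : Fin n → OpMap H} (hX : ∀ j, IsSubOp (X j))
    (hfix : affineMap T G X = X) (k : ℕ) (j : Fin n) {P : H →ₗ[ℂ] H} (hP : P.IsPositive) :
    (X j P - approx T G k j P).IsPositive := by
  induction k generalizing j P with
  | zero => simpa [approx] using (hX j).1.isPositive hP
  | succ k ih =>
    have := h.affineMap_mono (fun i P hP => ih i hP) j hP
    rwa [hfix] at this

theorem IsSystem.exists_leastFixedPoint [FiniteDimensional ℂ H] (h : IsSystem T G) :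
    ∃ F, IsLeastFixedPoint T G F ∧ ∀ j, TendstoOp (fun k => approx T G k j) (F j) := by
  choose F hF using fun j => exists_tendstoOp (fun k => h.approx_isSuperOp k j)
    (fun k P hP => h.approx_mono k j hP) (fun k => h.approx_traceLE k j)
  refine ⟨F, ⟨fun j => ⟨(hF j).isSuperOp fun k => h.approx_isSuperOp k j,
    (hF j).traceLE fun k => h.approx_traceLE k j⟩, ?_, ?_⟩, hF⟩
  · funext j
    -- The shifted sequence converges to the limit and, by continuity of `f`, also to its image
    -- under `f`.
    refine TendstoOp.unique (X := fun k => approx T G (k + 1) j) (fun A v => ?_)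
      (fun A v => (tendsto_add_atTop_iff_nat 1).2 (hF j A v))
    simp only [approx, affineMap, LinearMap.add_apply, LinearMap.sum_apply, LinearMap.comp_apply]
    exact (tendsto_finsetSum _ fun i _ => hF i _ _).add tendsto_const_nhds
  · intro X hX hfix j ρ hρ
    rw [isPositive_iff_inner]
    intro v
    have hpos := fun k => (isPositive_iff_inner _).1 (h.approx_le hX hfix k j hρ.1) v
    have ht : Tendsto (fun k => (inner ℂ v ((X j ρ - approx T G k j ρ) v) : ℂ)) atTop
        (𝓝 (inner ℂ v ((X j ρ - F j ρ) v))) := by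
      simp only [LinearMap.sub_apply]
      exact tendsto_const_nhds.inner (tendsto_const_nhds.sub (hF j ρ v))
    exact ⟨ge_of_tendsto' ((Complex.continuous_re.tendsto _).comp ht) fun k => (hpos k).1,
      tendsto_nhds_unique ((Complex.continuous_im.tendsto _).comp ht)
        (tendsto_const_nhds.congr fun k => (hpos k).2.symm)⟩

theorem LoewnerLE.antisymm [FiniteDimensional ℂ H] {E F : OpMap H} (h₁ : LoewnerLE E F)
    (h₂ : LoewnerLE F E) :
    E = F := by
  have hpos : ∀ P : H →ₗ[ℂ] H, P.IsPositive → E P = F P := by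
    intro P hP
    have hEF := h₁.apply_positive hP
    rw [eq_comm, ← sub_eq_zero, ← hEF.isSymmetric.inner_map_self_eq_zero]
    intro v
    have a1 := (isPositive_iff_inner _).1 hEF v
    have a2 := (isPositive_iff_inner _).1 (h₂.apply_positive hP) v
    rw [← neg_sub, LinearMap.neg_apply, inner_neg_right, Complex.neg_re] at a2
    rw [← inner_conj_symm, map_eq_zero]
    exact Complex.ext (le_antisymm (by simpa using a2.1) a1.1) a1.2
  refine LinearMap.ext fun A => ?_
  obtain ⟨c, P, hP, rfl⟩ := exists_positive_decomposition A
  simp only [map_sum, map_smul, hpos _ (hP _)]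

/-- `⊑` is antisymmetric, so any least fixed point is the Kleene limit. Later arguments use it only
as this limit. -/
theorem IsLeastFixedPoint.tendstoOp [FiniteDimensional ℂ H] (h : IsSystem T G)
    {F : Fin n → OpMap H}
    (hF : IsLeastFixedPoint T G F) (j : Fin n) : TendstoOp (fun k => approx T G k j) (F j) := by
  obtain ⟨F', hF', ht⟩ := h.exists_leastFixedPoint
  have : F j = F' j := (hF.least F' hF'.mem hF'.fixed j).antisymm (hF'.least F hF.mem hF.fixed j)
  rw [this]
  exact ht j

end FixedPoint

/-! ### Orbits of row vectors under a Jordan form. -/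

section JordanAnalysis

open Filter Topology Matrix

variable {m : ℕ} {J : Matrix (Fin m) (Fin m) ℂ}

theorem IsJordanForm.vecMul_succ (hJ : IsJordanForm J) (x : Fin m → ℂ) {p q : Fin m}
    (hpq : (q : ℕ) = p + 1) : (x ᵥ* J) q = x q * J q q + x p * J p q := by
  have hne : q ≠ p := fun h => by simp [h] at hpq
  refine Eq.trans ?_ (Finset.sum_pair (f := fun r => x r * J r q) hne)
  refine (Finset.sum_subset (f := fun r => x r * J r q) (Finset.subset_univ _)
    fun r _ hr => ?_).symm
  simp only [Finset.mem_insert, Finset.mem_singleton, not_or] at hr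
  rw [hJ.1 r q (Ne.symm hr.1), mul_zero]
  exact fun h => hr.2 (Fin.ext (by omega))

theorem IsJordanForm.vecMul_zero (hJ : IsJordanForm J) (x : Fin m → ℂ) {q : Fin m}
    (hq : (q : ℕ) = 0) : (x ᵥ* J) q = x q * J q q := by
  refine Finset.sum_eq_single_of_mem (f := fun r => x r * J r q) q (Finset.mem_univ _)
    fun r _ hr => ?_
  rw [hJ.1 r q (Ne.symm hr), mul_zero]
  omega

/-- If the orbit of a row vector under a Jordan form tends to zero, the vector has no component
in the blocks whose eigenvalue has absolute value at least one. -/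
theorem IsJordanForm.eq_zero_of_tendsto (hJ : IsJordanForm J) (p : Fin m) (x : Fin m → ℂ)
    (hx : ∀ q, Tendsto (fun k : ℕ => (x ᵥ* J ^ k) q) atTop (𝓝 0)) (hp : 1 ≤ ‖J p p‖) :
    x p = 0 := by
  obtain ⟨i, hi⟩ : ∃ i, i = (p : ℕ) := ⟨_, rfl⟩
  induction i generalizing p x with
  | zero =>
    have hk : ∀ k : ℕ, (x ᵥ* J ^ k) p = x p * J p p ^ k := by
      intro k
      induction k with
      | zero => simp
      | succ k ih =>
        rw [pow_succ, ← Matrix.vecMul_vecMul, hJ.vecMul_zero _ hi.symm, ih, pow_succ, mul_assoc]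
    have := (hx p).norm
    simp only [hk, norm_mul, norm_pow, norm_zero] at this
    -- `|x_p| ≤ |x_p| |λ|ᵏ`, and the right side tends to `0`.
    refine norm_le_zero_iff.1 (ge_of_tendsto' this fun k => ?_)
    exact le_mul_of_one_le_right (norm_nonneg _) (one_le_pow₀ hp)
  | succ i ih =>
    let p' : Fin m := ⟨i, by omega⟩
    have hpp : (p : ℕ) = p' + 1 := hi.symm
    -- Either a new block starts at `p`, or `p'` lies in the same block. In the second case the
    -- orbit of `x J ^ k` also tends to `0`, and the induction hypothesis kills its component `p'`.
    -- So the component `p` is just multiplied by the eigenvalue in each round.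
    have hz : ∀ k : ℕ, (x ᵥ* J ^ k) p' * J p' p = 0 := by
      intro k
      rcases hJ.2 p' p hpp with h | ⟨-, h⟩
      · rw [h, mul_zero]
      · rw [ih p' (x ᵥ* J ^ k) (fun q => ?_) (h ▸ hp) rfl, zero_mul]
        refine ((tendsto_add_atTop_iff_nat k).2 (hx q)).congr fun l => ?_
        rw [Matrix.vecMul_vecMul, ← pow_add, add_comm]
    have hk : ∀ k : ℕ, (x ᵥ* J ^ k) p = x p * J p p ^ k := by
      intro k
      induction k with
      | zero => simp
      | succ k ih =>
        rw [pow_succ, ← Matrix.vecMul_vecMul, hJ.vecMul_succ _ hpp, hz, ih, pow_succ, mul_assoc,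
          add_zero]
    have := (hx p).norm
    simp only [hk, norm_mul, norm_pow, norm_zero] at this
    refine norm_le_zero_iff.1 (ge_of_tendsto' this fun k => ?_)
    exact le_mul_of_one_le_right (norm_nonneg _) (one_le_pow₀ hp)

theorem tendsto_vecMul {ι κ : Type*} [Fintype ι] {z : ℕ → ι → ℂ} {y : ι → ℂ}
    (hz : ∀ p, Tendsto (fun k => z k p) atTop (𝓝 (y p))) (A : Matrix ι κ ℂ) (q : κ) :
    Tendsto (fun k => (z k ᵥ* A) q) atTop (𝓝 ((y ᵥ* A) q)) :=
  tendsto_finsetSum _ fun p _ => (hz p).mul_const _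

/-- The limit of the iteration `z ↦ z J + a`, started in zero, is a fixed point without
components in the blocks whose eigenvalue has absolute value at least one. -/
theorem IsJordanForm.limit_spec (hJ : IsJordanForm J) {z : ℕ → Fin m → ℂ} {y a : Fin m → ℂ}
    (h0 : z 0 = 0) (hs : ∀ k, z (k + 1) = z k ᵥ* J + a)
    (hz : ∀ p, Tendsto (fun k => z k p) atTop (𝓝 (y p))) :
    y = y ᵥ* J + a ∧ ∀ p, 1 ≤ ‖J p p‖ → y p = 0 := by
  constructor
  · funext q
    refine tendsto_nhds_unique ((tendsto_add_atTop_iff_nat 1).2 (hz q)) ?_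
    simp only [hs, Pi.add_apply]
    exact (tendsto_vecMul hz J q).add_const _
  · intro p hp
    have hdiff : ∀ k : ℕ, z (k + 1) = z k + a ᵥ* J ^ k := by
      intro k
      induction k with
      | zero => simp [hs, h0]
      | succ k ih =>
        conv_lhs => rw [hs, ih, Matrix.add_vecMul, Matrix.vecMul_vecMul, ← pow_succ,
          add_right_comm, ← hs]
    have ha : ∀ q, Tendsto (fun k : ℕ => (a ᵥ* J ^ k) q) atTop (𝓝 0) := by
      intro q
      have := ((tendsto_add_atTop_iff_nat 1).2 (hz q)).sub (hz q)
      simpa [hdiff] using this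
    -- Each `z k` is a sum of vectors `a J ^ l`, whose own orbits tend to `0`.
    have hzero : ∀ k, z k p = 0 := by
      intro k
      induction k with
      | zero => simp [h0]
      | succ k ih =>
        rw [hdiff, Pi.add_apply, ih, zero_add]
        refine hJ.eq_zero_of_tendsto p _ (fun q => ?_) hp
        refine ((tendsto_add_atTop_iff_nat k).2 (ha q)).congr fun l => ?_
        rw [Matrix.vecMul_vecMul, ← pow_add, add_comm]
    exact tendsto_nhds_unique (hz p) (by simp [hzero])

/-- The matrix is upper triangular, with diagonal entries `1` on the deleted blocks and `1 - λ`,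
where `|λ| < 1`, on the others. -/
theorem IsJordanForm.isUnit_one_sub_truncate (hJ : IsJordanForm J) :
    IsUnit (1 - truncate J) := by
  have htri : (1 - truncate J).IsUpperTriangular := by
    intro p q hpq
    have hpq' : q < p := hpq
    have : truncate J p q = 0 := by
      rw [truncate]
      split_ifs
      · rfl
      · exact hJ.1 p q hpq'.ne (by have : (q : ℕ) < p := hpq'; omega)
    rw [Matrix.sub_apply, Matrix.one_apply_ne hpq'.ne', this, sub_zero]
  rw [Matrix.isUnit_iff_isUnit_det, Matrix.det_of_isUpperTriangular htri, isUnit_iff_ne_zero,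
    Finset.prod_ne_zero_iff]
  intro p _ h
  rw [Matrix.sub_apply, Matrix.one_apply_eq, sub_eq_zero, truncate] at h
  split_ifs at h with h1
  · exact one_ne_zero h
  · exact h1 (by rw [← h, norm_one])

/-- Truncation clears exactly those rows of `J` that are weighted by a vanishing component of `y`.
-/
theorem truncate_vecMul {y : Fin m → ℂ} (hy : ∀ p, 1 ≤ ‖J p p‖ → y p = 0) :
    y ᵥ* truncate J = y ᵥ* J := by
  funext q
  simp only [Matrix.vecMul, dotProduct]
  refine Finset.sum_congr rfl fun p _ => ?_
  rw [truncate]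
  split_ifs with h
  · rw [hy p h, zero_mul, zero_mul]
  · rfl

end JordanAnalysis

/-! ### Matrix representations and the formula for the least fixed point. -/

section MatrixRep

open Filter Topology Matrix

variable {H : Type*} [NormedAddCommGroup H] [InnerProductSpace ℂ H]

/-- The operator `|u⟩⟨v|`. -/
abbrev ketBra (u v : H) : H →ₗ[ℂ] H := (InnerProductSpace.rankOne ℂ u v : H →ₗ[ℂ] H)

theorem ketBra_apply (u v w : H) : ketBra u v w = inner ℂ v w • u := by
  simp [ketBra]

theorem sum_smul_ketBra {d : ℕ} (b : OrthonormalBasis (Fin d) ℂ H) (A : H →ₗ[ℂ] H) :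
    A = ∑ s : Fin d × Fin d, (inner ℂ (b s.1) (A (b s.2)) : ℂ) • ketBra (b s.1) (b s.2) := by
  refine LinearMap.ext fun v => ?_
  simp only [LinearMap.sum_apply, LinearMap.smul_apply, ketBra_apply, Fintype.sum_prod_type_right]
  conv_lhs => rw [← b.sum_repr' v, map_sum]
  refine Finset.sum_congr rfl fun c _ => ?_
  rw [map_smul]
  conv_lhs => rw [← b.sum_repr' (A (b c)), Finset.smul_sum]
  exact Finset.sum_congr rfl fun a _ => smul_comm _ _ _

theorem matrixRep_comp {d : ℕ} (b : OrthonormalBasis (Fin d) ℂ H) (E F : OpMap H) :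
    matrixRep b (E ∘ₗ F) = matrixRep b E * matrixRep b F := by
  ext r s
  rw [Matrix.mul_apply]
  conv_lhs => rw [matrixRep, LinearMap.comp_apply, sum_smul_ketBra b (F _)]
  simp only [map_sum, map_smul, LinearMap.sum_apply, LinearMap.smul_apply, inner_sum,
    inner_smul_right]
  exact Finset.sum_congr rfl fun _ _ => mul_comm _ _

theorem matrixRep_add {d : ℕ} (b : OrthonormalBasis (Fin d) ℂ H) (E F : OpMap H) :
    matrixRep b (E + F) = matrixRep b E + matrixRep b F := by
  ext r s
  simp [matrixRep]

theorem matrixRep_sum {d : ℕ} (b : OrthonormalBasis (Fin d) ℂ H) {ι : Type*} (s : Finset ι)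
    (E : ι → OpMap H) : matrixRep b (∑ i ∈ s, E i) = ∑ i ∈ s, matrixRep b (E i) := by
  ext r c
  simp [matrixRep, Matrix.sum_apply, LinearMap.sum_apply]

theorem matrixRepRow_affineMap {n d : ℕ} (b : OrthonormalBasis (Fin d) ℂ H)
    (T : Matrix (Fin n) (Fin n) (OpMap H)) (G X : Fin n → OpMap H) :
    matrixRepRow b (affineMap T G X) =
      matrixRepRow b X * matrixRepSquare b T + matrixRepRow b G := by
  ext r s
  rw [Matrix.add_apply, Matrix.mul_apply, Fintype.sum_prod_type]
  simp only [matrixRepRow, matrixRepSquare, affineMap, matrixRep_add, matrixRep_sum,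
    matrixRep_comp, Matrix.add_apply, Matrix.sum_apply, Matrix.mul_apply]

variable {n d : ℕ} {T : Matrix (Fin n) (Fin n) (OpMap H)} {G F : Fin n → OpMap H}

/-- The rows of `M_F S` satisfy `y = y J + x` with `x` the rows of `M_G S`, and vanish on the
blocks whose eigenvalue has absolute value at least one. -/
theorem IsLeastFixedPoint.row_spec [FiniteDimensional ℂ H] (h : IsSystem T G)
    (hF : IsLeastFixedPoint T G F) (b : OrthonormalBasis (Fin d) ℂ H) {m : ℕ}
    {S : Matrix (Fin n × Fin d × Fin d) (Fin m) ℂ} {J : Matrix (Fin m) (Fin m) ℂ}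
    {S' : Matrix (Fin m) (Fin n × Fin d × Fin d) ℂ}
    (hd : IsJordanDecomp (matrixRepSquare b T) S J S') (u : Fin d × Fin d → ℂ) :
    (u ᵥ* matrixRepRow b F) ᵥ* S =
        ((u ᵥ* matrixRepRow b F) ᵥ* S) ᵥ* J + (u ᵥ* matrixRepRow b G) ᵥ* S ∧
      ∀ p, 1 ≤ ‖J p p‖ → ((u ᵥ* matrixRepRow b F) ᵥ* S) p = 0 := by
  -- The Kleene sequence in Jordan coordinates: multiplying by `S` on the right turns `M_T` into
  -- `J`.
  refine hd.jordan.limit_spec (z := fun k => (u ᵥ* matrixRepRow b (approx T G k)) ᵥ* S) ?_ ?_ ?_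
  · have : matrixRepRow b (approx T G 0) = 0 := by
      ext r s
      simp [approx, matrixRepRow, matrixRep]
    simp [this]
  · intro k
    rw [approx, matrixRepRow_affineMap, Matrix.vecMul_add, Matrix.add_vecMul, hd.eq]
    simp only [Matrix.vecMul_vecMul, Matrix.mul_assoc, hd.inv_mul, Matrix.mul_one]
  · refine fun p => tendsto_vecMul (fun q => ?_) S p
    refine tendsto_finsetSum _ fun r _ => tendsto_const_nhds.mul ?_
    exact (hF.tendstoOp h q.1).matrixRep b r q.2

theorem IsLeastFixedPoint.matrixRepRow_eq [FiniteDimensional ℂ H] (h : IsSystem T G)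
    (hF : IsLeastFixedPoint T G F) (b : OrthonormalBasis (Fin d) ℂ H) {m : ℕ}
    {S : Matrix (Fin n × Fin d × Fin d) (Fin m) ℂ} {J : Matrix (Fin m) (Fin m) ℂ}
    {S' : Matrix (Fin m) (Fin n × Fin d × Fin d) ℂ}
    (hd : IsJordanDecomp (matrixRepSquare b T) S J S') :
    IsUnit (1 - S * truncate J * S') ∧
      matrixRepRow b F = matrixRepRow b G * (1 - S * truncate J * S')⁻¹ := by
  have hconj : 1 - S * truncate J * S' = S * (1 - truncate J) * S' := by
    rw [Matrix.mul_sub, Matrix.sub_mul, Matrix.mul_one, hd.mul_inv]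
  have hunit : IsUnit (1 - S * truncate J * S') := by
    obtain ⟨N, hN⟩ := hd.jordan.isUnit_one_sub_truncate.exists_right_inv
    refine IsUnit.of_mul_eq_one (S * N * S') ?_
    rw [hconj, show S * (1 - truncate J) * S' * (S * N * S') =
      S * ((1 - truncate J) * (S' * S) * N) * S' by simp only [Matrix.mul_assoc], hd.inv_mul,
      Matrix.mul_one, hN, Matrix.mul_one, hd.mul_inv]
  refine ⟨hunit, ?_⟩
  have hrow : matrixRepRow b F * S * (1 - truncate J) = matrixRepRow b G * S := by
    refine Matrix.ext_of_single_vecMul fun r => ?_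
    -- Here `u` is a unit vector, picking out row `r`; the algorithm uses the same result with `u`
    -- the trace functional.
    obtain ⟨h1, h2⟩ := hF.row_spec h b hd (Pi.single r 1)
    rw [Matrix.mul_sub, Matrix.mul_one, Matrix.vecMul_sub, ← Matrix.vecMul_vecMul _ _ (truncate J),
      ← Matrix.vecMul_vecMul, truncate_vecMul h2, sub_eq_iff_eq_add', ← Matrix.vecMul_vecMul]
    exact h1
  have hmul : matrixRepRow b F * (1 - S * truncate J * S') = matrixRepRow b G := by
    rw [hconj, ← Matrix.mul_assoc, ← Matrix.mul_assoc, hrow, Matrix.mul_assoc, hd.mul_inv,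
      Matrix.mul_one]
  rw [← hmul, Matrix.mul_assoc, Matrix.mul_nonsing_inv _ ((Matrix.isUnit_iff_isUnit_det _).1 hunit),
    Matrix.mul_one]

end MatrixRep

/-! ### Existence of Jordan decompositions. -/

section JordanExistence

open Polynomial Module

/-- The module `ℂ[X] / (X - a)ᵉ` has a basis which is a Jordan chain for the
multiplication by `X`. -/
theorem exists_basis_quotient_pow (a : ℂ) (e : ℕ) :
    ∃ B : Basis (Fin e) ℂ (ℂ[X] ⧸ Ideal.span {(X - C a) ^ e}),
      ∀ k, B k = Submodule.Quotient.mk ((X - C a) ^ (e - 1 - k)) := by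
  -- The exponents descend, so that `X - a` sends each vector to its predecessor and the ones appear
  -- above the diagonal.
  let v : Fin e → ℂ[X] ⧸ Ideal.span {(X - C a) ^ e} :=
    fun k => Submodule.Quotient.mk ((X - C a) ^ (e - 1 - (k : ℕ)))
  have hspan : ⊤ ≤ Submodule.span ℂ (Set.range v) := by
    rintro x -
    obtain ⟨f, rfl⟩ := Submodule.Quotient.mk_surjective _ x
    -- The Taylor expansion at `a` shows that the powers of `X - a` span; those of exponent at least
    -- `e` vanish in the quotient.
    rw [← sum_taylor_eq f a, Polynomial.sum, ← Submodule.mkQ_apply, map_sum]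
    refine Submodule.sum_mem _ fun i _ => ?_
    rw [← smul_eq_C_mul, Submodule.mkQ_apply, Submodule.Quotient.mk_smul]
    refine Submodule.smul_mem _ _ ?_
    rcases lt_or_ge i e with hi | hi
    · refine Submodule.subset_span ⟨⟨e - 1 - i, by omega⟩, ?_⟩
      simp only [v]
      congr 2
      omega
    · have : (Submodule.Quotient.mk ((X - C a) ^ i) : ℂ[X] ⧸ Ideal.span {(X - C a) ^ e}) = 0 := by
        rw [Submodule.Quotient.mk_eq_zero, Ideal.mem_span_singleton]
        exact pow_dvd_pow _ hi
      rw [this]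
      exact Submodule.zero_mem _
  have hcard : Fintype.card (Fin e) = finrank ℂ (ℂ[X] ⧸ Ideal.span {(X - C a) ^ e}) := by
    rw [finrank_quotient_span_eq_natDegree, natDegree_pow, natDegree_X_sub_C, Fintype.card_fin,
      mul_one]
  exact ⟨basisOfTopLeSpanOfCardEqFinrank v hspan hcard, fun k => by
    rw [coe_basisOfTopLeSpanOfCardEqFinrank]⟩

/-- Over `ℂ` an irreducible polynomial is associated to some `X - a`, so each primary cyclic module
is a single Jordan block. -/
theorem exists_jordan_chain {p : ℂ[X]} (hp : Irreducible p) (e : ℕ) :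
    ∃ (a : ℂ) (B : Basis (Fin e) ℂ (ℂ[X] ⧸ Submodule.span ℂ[X] {p ^ e})), ∀ k : Fin e,
      (X : ℂ[X]) • B k = a • B k + if h : 0 < (k : ℕ) then B ⟨k - 1, by omega⟩ else 0 := by
  obtain ⟨a, ha⟩ := IsAlgClosed.exists_root p (degree_pos_of_irreducible hp).ne'
  have hassoc : Associated p (X - C a) :=
    ((irreducible_X_sub_C a).associated_of_dvd hp (dvd_iff_isRoot.2 ha)).symm
  have hspan : Submodule.span ℂ[X] {p ^ e} = Ideal.span {(X - C a) ^ e} :=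
    Ideal.span_singleton_eq_span_singleton.2 (hassoc.pow_pow)
  rw [hspan]
  obtain ⟨B, hB⟩ := exists_basis_quotient_pow a e
  refine ⟨a, B, fun k => ?_⟩
  rw [hB, ← Submodule.Quotient.mk_smul, ← Submodule.Quotient.mk_smul]
  have hX : (X : ℂ[X]) • (X - C a) ^ (e - 1 - (k : ℕ)) =
      a • (X - C a) ^ (e - 1 - (k : ℕ)) + (X - C a) ^ (e - k) := by
    rw [smul_eq_C_mul, smul_eq_mul, show e - (k : ℕ) = e - 1 - k + 1 by omega, pow_succ]
    ring
  rw [hX, Submodule.Quotient.mk_add]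
  congr 1
  split_ifs with h
  · rw [hB]
    congr 2
    simp only
    omega
  · rw [Submodule.Quotient.mk_eq_zero, Ideal.mem_span_singleton]
    exact pow_dvd_pow _ (by omega)

/-- An endomorphism of a finite-dimensional complex vector space has a basis of Jordan chains. -/
theorem exists_jordan_basis {V : Type} [AddCommGroup V] [Module ℂ V] [FiniteDimensional ℂ V]
    (f : V →ₗ[ℂ] V) :
    ∃ (N : ℕ) (e : Fin N → ℕ) (a : Fin N → ℂ) (B : Basis (Σ i, Fin (e i)) ℂ V),
      ∀ s, f (B s) = a s.1 • B s +
        if h : 0 < (s.2 : ℕ) then B ⟨s.1, ⟨s.2 - 1, by omega⟩⟩ else 0 := by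
  classical
  -- View `V` as a torsion `ℂ[X]`-module with `X` acting as `f`, and split it into primary cyclic
  -- summands.
  obtain ⟨ι, _, p, hp, e, ⟨φ⟩⟩ :=
    Module.equiv_directSum_of_isTorsion (AEval.isTorsion_of_finiteDimensional ℂ V f)
  choose a B hB using fun i => exists_jordan_chain (hp i) (e i)
  let φ' := φ.trans (DirectSum.linearEquivFunOnFintype ℂ[X] ι _)
  let ψ := (AEval'.of f).trans (φ'.restrictScalars ℂ)
  let D := (Pi.basis B).map ψ.symm
  have hD : ∀ s, D s = ψ.symm (Pi.single s.1 (B s.1 s.2)) := fun s => by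
    simp only [D, Basis.map_apply, Pi.basis_apply]
  have hfψ : ∀ w, f (ψ.symm w) = ψ.symm ((X : ℂ[X]) • w) := fun w =>
    (AEval'.of_symm_X_smul f (φ'.symm w)).symm.trans
      (congrArg (AEval'.of f).symm (φ'.symm.map_smul X w).symm)
  have hf : ∀ s, f (D s) = a s.1 • D s +
      if h : 0 < (s.2 : ℕ) then D ⟨s.1, ⟨s.2 - 1, by omega⟩⟩ else 0 := by
    intro s
    rw [hD, hfψ, ← Pi.single_smul, hB, Pi.single_add, map_add, Pi.single_smul, map_smul]
    congr 1
    split_ifs with h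
    · rw [hD]
    · rw [Pi.single_zero, map_zero]
  let σ := Fintype.equivFin ι
  let τ : (Σ i, Fin (e i)) ≃ Σ i, Fin (e (σ.symm i)) :=
    (Equiv.sigmaCongrLeft (β := fun i => Fin (e i)) σ.symm).symm
  have hτ : ∀ s, τ.symm s = ⟨σ.symm s.1, s.2⟩ := fun s => rfl
  refine ⟨_, fun i => e (σ.symm i), fun i => a (σ.symm i), D.reindex τ, fun s => ?_⟩
  simp only [Basis.reindex_apply, hτ, hf]

theorem finSigmaFinEquiv_eq_add_one {N : ℕ} {e : Fin N → ℕ} {i : Fin N} (k k' : Fin (e i))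
    (h : (k' : ℕ) = k + 1) :
    (finSigmaFinEquiv (⟨i, k'⟩ : Σ i, Fin (e i)) : ℕ) =
      finSigmaFinEquiv (⟨i, k⟩ : Σ i, Fin (e i)) + 1 := by
  rw [finSigmaFinEquiv_apply, finSigmaFinEquiv_apply, h, add_assoc]

/-- Every complex matrix has a Jordan decomposition. -/
theorem exists_jordanDecomp {m : ℕ} (M : Matrix (Fin m) (Fin m) ℂ) :
    ∃ S J S' : Matrix (Fin m) (Fin m) ℂ, IsJordanDecomp M S J S' := by
  obtain ⟨N, e, a, B, hB⟩ := exists_jordan_basis (Matrix.toLin' M)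
  have hm : ∑ i, e i = m := by
    have := Module.finrank_eq_card_basis (B.reindex finSigmaFinEquiv)
    rwa [Module.finrank_fin_fun, Fintype.card_fin, eq_comm] at this
  subst hm
  let D := B.reindex finSigmaFinEquiv
  have hJ : ∀ s t : Σ i, Fin (e i),
      LinearMap.toMatrix D D (Matrix.toLin' M) (finSigmaFinEquiv s) (finSigmaFinEquiv t) =
        (if s = t then a t.1 else 0) + if t.1 = s.1 ∧ (t.2 : ℕ) = s.2 + 1 then 1 else 0 := by
    intro s t
    simp only [LinearMap.toMatrix_apply, D, Basis.reindex_apply, Basis.repr_reindex_apply,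
      Equiv.symm_apply_apply, hB, map_add, map_smul, Finsupp.add_apply, Finsupp.smul_apply,
      Basis.repr_self, Finsupp.single_apply, smul_eq_mul, mul_ite, mul_one, mul_zero,
      eq_comm (a := t)]
    congr 1
    split_ifs with h1 h2 h2
    · obtain ⟨i, k⟩ := s
      obtain ⟨j, l⟩ := t
      obtain ⟨rfl, hkl⟩ := h2
      simp only at hkl
      simp [Basis.repr_self, hkl]
    · rw [Basis.repr_self, Finsupp.single_apply, if_neg]
      rintro rfl
      exact h2 ⟨rfl, by simp only; omega⟩
    · omega
    · rw [map_zero, Finsupp.zero_apply]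
  refine ⟨(Pi.basisFun ℂ _).toMatrix D, LinearMap.toMatrix D D (Matrix.toLin' M),
    D.toMatrix (Pi.basisFun ℂ _), ?_, ?_, ⟨fun p q hqp hqp' => ?_, fun p q hpq => ?_⟩, ?_⟩
  · exact Basis.toMatrix_mul_toMatrix_flip _ _
  · exact Basis.toMatrix_mul_toMatrix_flip _ _
  · obtain ⟨⟨i, k⟩, rfl⟩ := finSigmaFinEquiv.surjective p
    obtain ⟨⟨j, l⟩, rfl⟩ := finSigmaFinEquiv.surjective q
    rw [hJ, if_neg fun h => hqp (by rw [h]), if_neg, add_zero]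
    rintro ⟨h, hkl⟩
    obtain rfl : j = i := h
    exact hqp' (finSigmaFinEquiv_eq_add_one k l hkl)
  · obtain ⟨⟨i, k⟩, rfl⟩ := finSigmaFinEquiv.surjective p
    obtain ⟨⟨j, l⟩, rfl⟩ := finSigmaFinEquiv.surjective q
    have hne : (⟨i, k⟩ : Σ i, Fin (e i)) ≠ ⟨j, l⟩ := fun h => by simp [h] at hpq
    -- Neighbouring indices either belong to one chain, giving the entry `1` and equal eigenvalues,
    -- or separate two chains, giving `0`.
    simp only [hJ, if_neg hne, if_true, zero_add]
    by_cases h : j = i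
    · subst h
      split_ifs <;> first | omega | simp
    · simp [h]
  · rw [basis_toMatrix_mul_linearMap_toMatrix_mul_basis_toMatrix]
    exact (LinearMap.toMatrix'_toLin' M).symm

end JordanExistence

/-! ### The relation `≲` as positivity of a Hermitian `d × d` matrix. -/

section TraceCriterion

open Matrix ComplexOrder

theorem IsJordanForm.isUpperTriangular {m : ℕ} {J : Matrix (Fin m) (Fin m) ℂ}
    (hJ : IsJordanForm J) : J.IsUpperTriangular := by
  intro p q hpq
  have hpq' : q < p := hpq
  exact hJ.1 p q hpq'.ne (by have : (q : ℕ) < p := hpq'; omega)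

/-- A Hermitian matrix is positive semidefinite iff the diagonal entries of a Jordan form have
nonnegative real parts. -/
theorem IsJordanDecomp.posSemidef_iff {m : ℕ} {D S J S' : Matrix (Fin m) (Fin m) ℂ}
    (h : IsJordanDecomp D S J S') (hD : D.IsHermitian) :
    D.PosSemidef ↔ ∀ p, 0 ≤ (J p p).re := by
  -- Similarity preserves the characteristic polynomial, so the diagonal of the triangular matrix
  -- `J` is the multiset of eigenvalues of `D`.
  have hchar : D.charpoly = ∏ p, (Polynomial.X - Polynomial.C (J p p)) := by
    rw [h.eq, Matrix.charpoly_mul_comm, ← Matrix.mul_assoc, h.inv_mul, Matrix.one_mul,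
      Matrix.charpoly_of_isUpperTriangular _ h.jordan.isUpperTriangular]
  have hroots := hD.roots_charpoly_eq_eigenvalues
  have hdiag : (∏ p, (Polynomial.X - Polynomial.C (J p p))).roots =
      Multiset.map (fun p => J p p) Finset.univ.val := by
    rw [Polynomial.roots_prod]
    · simp
    · simp [Finset.prod_ne_zero_iff, Polynomial.X_sub_C_ne_zero]
  rw [hchar, hdiag] at hroots
  rw [hD.posSemidef_iff_eigenvalues_nonneg]
  constructor
  · intro hnn p
    have hp : J p p ∈ Multiset.map (fun p => J p p) Finset.univ.val :=
      Multiset.mem_map_of_mem _ (Finset.mem_univ_val p)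
    rw [hroots, Multiset.mem_map] at hp
    obtain ⟨i, -, hi⟩ := hp
    rw [← hi]
    simpa using hnn i
  · intro hnn i
    have hp : ((hD.eigenvalues i : ℝ) : ℂ) ∈
        Multiset.map ((fun x : ℝ => (x : ℂ)) ∘ hD.eigenvalues) Finset.univ.val :=
      Multiset.mem_map_of_mem ((fun x : ℝ => (x : ℂ)) ∘ hD.eigenvalues) (Finset.mem_univ_val i)
    have hp' := hroots.symm ▸ hp
    rw [Multiset.mem_map] at hp'
    obtain ⟨p, -, hp⟩ := hp'
    have := hnn p
    rw [hp, Complex.ofReal_re] at this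
    exact this

variable {H : Type*} [NormedAddCommGroup H] [InnerProductSpace ℂ H]

/-- The traces of the values of a linear map at the matrix units `|c⟩⟨c'|`. -/
def traceRow {d : ℕ} (b : OrthonormalBasis (Fin d) ℂ H) (E : OpMap H) (s : Fin d × Fin d) : ℂ :=
  LinearMap.trace ℂ H (E (ketBra (b s.1) (b s.2)))

/-- The row vector of the trace functional. -/
def diagRow (d : ℕ) (r : Fin d × Fin d) : ℂ := if r.1 = r.2 then 1 else 0

theorem sum_diagRow_mul {d : ℕ} (g : Fin d × Fin d → ℂ) :
    ∑ r, diagRow d r * g r = ∑ a, g (a, a) := by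
  simp [diagRow, Fintype.sum_prod_type]

theorem traceRow_eq_sum {d : ℕ} (b : OrthonormalBasis (Fin d) ℂ H) (E : OpMap H)
    (s : Fin d × Fin d) : traceRow b E s = ∑ a, matrixRep b E (a, a) s :=
  LinearMap.trace_eq_sum_inner _ b

theorem diagRow_vecMul_matrixRepRow {n d : ℕ} (b : OrthonormalBasis (Fin d) ℂ H)
    (F : Fin n → OpMap H) (s : Fin n × Fin d × Fin d) :
    (diagRow d ᵥ* matrixRepRow b F) s = traceRow b (F s.1) s.2 :=
  (sum_diagRow_mul _).trans (traceRow_eq_sum b _ _).symm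

theorem ketBra_isPositive (v : H) : (ketBra v v).IsPositive := by
  rw [isPositive_iff_inner]
  intro w
  rw [ketBra_apply, inner_smul_right, ← inner_conj_symm v w, ← Complex.normSq_eq_conj_mul_self]
  exact ⟨by simpa using Complex.normSq_nonneg _, by simp⟩

/-- The matrix of the Hermitian form `v ↦ tr (F (|v⟩⟨v|)) - tr (E (|v⟩⟨v|))`. -/
def traceGap {d : ℕ} (b : OrthonormalBasis (Fin d) ℂ H) (E F : OpMap H) :
    Matrix (Fin d) (Fin d) ℂ :=
  fun c c' => traceRow b F (c, c') - traceRow b E (c, c')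

/-- The coordinates of the vector are conjugated because `|v⟩⟨v|` is antilinear in its second
factor, whereas `star x ⬝ᵥ D *ᵥ x` is antilinear in the first. -/
theorem star_dotProduct_traceGap {d : ℕ} (b : OrthonormalBasis (Fin d) ℂ H) (E F : OpMap H)
    (x : Fin d → ℂ) :
    star x ⬝ᵥ (traceGap b E F *ᵥ x) =
      LinearMap.trace ℂ H (F (ketBra (∑ c, star (x c) • b c) (∑ c, star (x c) • b c))) -
        LinearMap.trace ℂ H (E (ketBra (∑ c, star (x c) • b c) (∑ c, star (x c) • b c))) := by
  have hexp : ketBra (∑ c, star (x c) • b c) (∑ c, star (x c) • b c) =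
      ∑ c, ∑ c', (star (x c) * x c') • ketBra (b c) (b c') := by
    refine LinearMap.ext fun w => ?_
    simp only [ketBra_apply, LinearMap.sum_apply, LinearMap.smul_apply, sum_inner, Finset.smul_sum,
      inner_smul_left, smul_smul, Finset.sum_mul, Finset.sum_smul]
    refine Finset.sum_congr rfl fun c _ => Finset.sum_congr rfl fun c' _ => ?_
    congr 1
    rw [starRingEnd_apply, star_star]
    ring
  rw [hexp]
  simp only [map_sum, map_smul, smul_eq_mul, dotProduct, Matrix.mulVec, Finset.mul_sum,
    ← Finset.sum_sub_distrib, traceGap, traceRow, Pi.star_apply]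
  refine Finset.sum_congr rfl fun c _ => Finset.sum_congr rfl fun c' _ => ?_
  ring

variable [FiniteDimensional ℂ H]

theorem adjoint_ketBra (u v : H) : LinearMap.adjoint (ketBra u v) = ketBra v u := by
  symm
  rw [LinearMap.eq_adjoint_iff]
  intro x y
  rw [ketBra_apply, ketBra_apply, inner_smul_left, inner_smul_right, inner_conj_symm, mul_comm]

/-- Expand `A` in positive operators: these are self-adjoint and their images have real trace, so
only the coefficients get conjugated. -/
theorem IsSuperOp.trace_adjoint {E : OpMap H} (hE : IsSuperOp E) (A : H →ₗ[ℂ] H) :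
    LinearMap.trace ℂ H (E (LinearMap.adjoint A)) = star (LinearMap.trace ℂ H (E A)) := by
  obtain ⟨c, P, hP, rfl⟩ := exists_positive_decomposition A
  simp only [map_sum, LinearEquiv.map_smulₛₗ, (hP _).adjoint_eq, map_smul, star_sum, smul_eq_mul,
    star_mul']
  refine Finset.sum_congr rfl fun i _ => ?_
  rw [← IsPositive.ofReal_trace_re (hE.isPositive (hP i))]
  simp

theorem traceGap_isHermitian {d : ℕ} (b : OrthonormalBasis (Fin d) ℂ H) {E F : OpMap H}
    (hE : IsSuperOp E) (hF : IsSuperOp F) : (traceGap b E F).IsHermitian := by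
  ext c c'
  simp only [Matrix.conjTranspose_apply, traceGap, traceRow, star_sub, ← hE.trace_adjoint,
    ← hF.trace_adjoint, adjoint_ketBra]

/-- By the spectral theorem a density operator is a nonnegative combination of operators `|v⟩⟨v|`,
so it suffices to test these, and on them the trace difference is the quadratic form of `traceGap`.
-/
theorem traceLE_iff_posSemidef {d : ℕ} (b : OrthonormalBasis (Fin d) ℂ H) {E F : OpMap H}
    (hE : IsSuperOp E) (hF : IsSuperOp F) :
    TraceLE E F ↔ (traceGap b E F).PosSemidef := by
  rw [Matrix.posSemidef_iff_dotProduct_mulVec]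
  constructor
  · refine fun h => ⟨traceGap_isHermitian b hE hF, fun x => ?_⟩
    have hpos := ketBra_isPositive (∑ c, star (x c) • b c)
    rw [star_dotProduct_traceGap, ← IsPositive.ofReal_trace_re (hE.isPositive hpos),
      ← IsPositive.ofReal_trace_re (hF.isPositive hpos), ← Complex.ofReal_sub,
      Complex.zero_le_real, sub_nonneg]
    exact h.apply_positive hpos
  · rintro ⟨-, h⟩ ρ hρ
    have hket : ∀ v : H, (LinearMap.trace ℂ H (E (ketBra v v))).re ≤
        (LinearMap.trace ℂ H (F (ketBra v v))).re := by
      intro v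
      have := h fun c => star (b.repr v c)
      simp only [star_dotProduct_traceGap, star_star, b.sum_repr] at this
      have := (Complex.nonneg_iff.1 this).1
      rwa [Complex.sub_re, sub_nonneg] at this
    let e := hρ.1.isSymmetric.eigenvectorBasis rfl
    have hρe : ρ = ∑ i, ((hρ.1.isSymmetric.eigenvalues rfl i : ℝ) : ℂ) • ketBra (e i) (e i) := by
      conv_lhs => rw [sum_smul_ketBra e ρ]
      rw [Fintype.sum_prod_type_right]
      refine Finset.sum_congr rfl fun i _ => ?_
      rw [Finset.sum_eq_single_of_mem i (Finset.mem_univ _)]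
      · simp [e, LinearMap.IsSymmetric.apply_eigenvectorBasis]
      · intro j _ hj
        simp only [e, LinearMap.IsSymmetric.apply_eigenvectorBasis, inner_smul_right]
        rw [(hρ.1.isSymmetric.eigenvectorBasis rfl).inner_eq_zero hj, mul_zero, zero_smul]
    rw [hρe]
    simp only [map_sum, map_smul, Complex.re_sum, smul_eq_mul, Complex.re_ofReal_mul]
    exact Finset.sum_le_sum fun i _ =>
      mul_le_mul_of_nonneg_left (hket _) (hρ.1.nonneg_eigenvalues rfl i)

end TraceCriterion

/-! ### Reasoning rules for timed programs. -/

section Machine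

variable {O : JordanSubroutine}

/-- Started in `s`, the program halts within time `t` in a state satisfying `post`. -/
def Reaches (O : JordanSubroutine) (P : Program) (s : State) (t : ℕ) (post : State → Prop) :
    Prop :=
  ∃ (s' : State) (t' : ℕ), Run O P s s' t' ∧ t' ≤ t ∧ post s'

theorem Reaches.mono {P : Program} {s : State} {t t' : ℕ} {p q : State → Prop}
    (h : Reaches O P s t p) (ht : t ≤ t') (hpq : ∀ s', p s' → q s') : Reaches O P s t' q := by
  obtain ⟨s', u, hr, hu, hp⟩ := h
  exact ⟨s', u, hr, hu.trans ht, hpq s' hp⟩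

theorem Reaches.seq {P Q : Program} {s : State} {t₁ t₂ : ℕ} {p q : State → Prop}
    (hP : Reaches O P s t₁ p) (hQ : ∀ s₁, p s₁ → Reaches O Q s₁ t₂ q) :
    Reaches O (.seq P Q) s (t₁ + t₂) q := by
  obtain ⟨s₁, u₁, hr₁, hu₁, hp⟩ := hP
  obtain ⟨s₂, u₂, hr₂, hu₂, hq⟩ := hQ s₁ hp
  exact ⟨s₂, _, .seq hr₁ hr₂, add_le_add hu₁ hu₂, hq⟩

theorem Reaches.setReg {s : State} {r : ℕ} {e : NExpr} {q : State → Prop}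
    (h : q (s.setReg r (e.eval s))) : Reaches O (.setReg r e) s (e.cost + 1) q :=
  ⟨_, _, .setReg s r e, le_rfl, h⟩

theorem Reaches.setCell {s : State} {a : ℕ} {e : NExpr} {x : CExpr} {q : State → Prop}
    (h : q (s.setCell a (e.eval s) (x.eval s))) :
    Reaches O (.setCell a e x) s (e.cost + x.cost + 1) q :=
  ⟨_, _, .setCell s a e x, le_rfl, h⟩

theorem Reaches.skip {s : State} {q : State → Prop} (h : q s) : Reaches O .skip s 1 q :=
  ⟨_, _, .skip s, le_rfl, h⟩

theorem Reaches.branch {c : Test} {P Q : Program} {s : State} {t : ℕ} {q : State → Prop}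
    (hP : c.Holds s → Reaches O P s t q) (hQ : ¬ c.Holds s → Reaches O Q s t q) :
    Reaches O (.branch c P Q) s (c.cost + t) q := by
  by_cases hc : c.Holds s
  · obtain ⟨s', u, hr, hu, hq⟩ := hP hc
    exact ⟨s', _, .branch_true hc hr, Nat.add_le_add_left hu _, hq⟩
  · obtain ⟨s', u, hr, hu, hq⟩ := hQ hc
    exact ⟨s', _, .branch_false hc hr, Nat.add_le_add_left hu _, hq⟩

/-- `for r < N do body`. -/
def forLoop (r : ℕ) (N : NExpr) (body : Program) : Program :=
  .seq (.setReg r (.const 0))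
    (.loop (.lt (.reg r) N) (.seq body (.setReg r (.add (.reg r) (.const 1)))))

theorem State.setReg_reg_self (s : State) (r k : ℕ) : (s.setReg r k).reg r = k := by
  simp [State.setReg]

theorem State.setReg_reg_of_ne (s : State) {r r' : ℕ} (k : ℕ) (h : r' ≠ r) :
    (s.setReg r k).reg r' = s.reg r' := by
  simp [State.setReg, h]

theorem State.setReg_mem (s : State) (r k : ℕ) : (s.setReg r k).mem = s.mem := rfl

theorem State.setCell_mem_self (s : State) (a k : ℕ) (z : ℂ) : (s.setCell a k z).mem a k = z := by
  simp [State.setCell]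

theorem State.setCell_mem_of_ne (s : State) (a : ℕ) {k k' : ℕ} (z : ℂ) (h : k' ≠ k) :
    (s.setCell a k z).mem a k' = s.mem a k' := by
  simp [State.setCell, h]

theorem State.setCell_mem_of_array_ne (s : State) {a a' : ℕ} (k : ℕ) (z : ℂ) (h : a' ≠ a) :
    (s.setCell a k z).mem a' = s.mem a' := by
  simp [State.setCell, h]

/-- The rule for loops: `I k` is an invariant that holds before the `k`-th round. -/
theorem Reaches.forLoop {r : ℕ} {N : NExpr} {body : Program} {I : ℕ → State → Prop} {K c : ℕ}
    (hI : ∀ k s, I k s → s.reg r = k ∧ N.eval s = K)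
    (hbody : ∀ k < K, ∀ s, I k s →
      Reaches O body s c fun s' => s'.reg r = k ∧ I (k + 1) (s'.setReg r (k + 1)))
    {s : State} (h0 : I 0 (s.setReg r 0)) :
    Reaches O (forLoop r N body) s (K * (c + N.cost + 6) + N.cost + 4) (I K) := by
  -- Induction on the number `j` of remaining rounds. A round costs `c` for the body, `N.cost + 2`
  -- for the test and `4` for the increment.
  have hloop : ∀ j k s, k + j = K → I k s →
      Reaches O (.loop (.lt (.reg r) N) (.seq body (.setReg r (.add (.reg r) (.const 1))))) s
        (j * (c + N.cost + 6) + N.cost + 2) (I K) := by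
    intro j
    induction j with
    | zero =>
      intro k s hk hs
      obtain rfl : k = K := hk
      obtain ⟨h1, h2⟩ := hI _ s hs
      refine ⟨s, _, .loop_false ?_, ?_, hs⟩
      · simp [Test.Holds, NExpr.eval, h1, h2]
      · simp only [Test.cost, NExpr.cost]
        omega
    | succ j ih =>
      intro k s hk hs
      obtain ⟨h1, h2⟩ := hI _ s hs
      obtain ⟨s₁, t₁, hr₁, ht₁, hreg, hinv⟩ := hbody k (by omega) s hs
      obtain ⟨s₂, t₂, hr₂, ht₂, hs₂⟩ := ih (k + 1) _ (by omega) hinv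
      have hinc : Run O (.setReg r (.add (.reg r) (.const 1))) s₁ (s₁.setReg r (k + 1))
          ((NExpr.add (.reg r) (.const 1)).cost + 1) := by
        have := Run.setReg (O := O) s₁ r (.add (.reg r) (.const 1))
        simpa only [NExpr.eval, hreg] using this
      refine ⟨s₂, _, .loop_true ?_ (.seq hr₁ hinc) hr₂, ?_, hs₂⟩
      · simp only [Test.Holds, NExpr.eval, h1, h2]
        omega
      · simp only [Test.cost, NExpr.cost, Nat.succ_mul]
        omega
  refine (Reaches.seq (Reaches.setReg (q := I 0) h0)
    fun s₁ hs₁ => hloop K 0 s₁ (zero_add K) hs₁).mono ?_ fun _ h => h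
  simp only [NExpr.cost]
  omega

/-- The states agree outside the arrays in `A` and the registers in `R`. -/
def Frame (A R : Finset ℕ) (s s' : State) : Prop :=
  (∀ a ∉ A, s'.mem a = s.mem a) ∧ ∀ r ∉ R, s'.reg r = s.reg r

theorem Frame.refl (A R : Finset ℕ) (s : State) : Frame A R s s :=
  ⟨fun _ _ => rfl, fun _ _ => rfl⟩

theorem Frame.setReg {A R : Finset ℕ} {s s' : State} (h : Frame A R s s') {r : ℕ} (hr : r ∈ R)
    (k : ℕ) : Frame A R s (s'.setReg r k) :=
  ⟨h.1, fun r' hr' => by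
    rw [State.setReg_reg_of_ne _ _ (ne_of_mem_of_not_mem hr hr').symm, h.2 r' hr']⟩

theorem Frame.setCell {A R : Finset ℕ} {s s' : State} (h : Frame A R s s') {a : ℕ} (ha : a ∈ A)
    (k : ℕ) (z : ℂ) : Frame A R s (s'.setCell a k z) :=
  ⟨fun a' ha' => by
    rw [State.setCell_mem_of_array_ne _ _ _ (ne_of_mem_of_not_mem ha ha').symm, h.1 a' ha'], h.2⟩

/-- For each `i < N`, store `∑ k < K, term` in the cell `i` of array `a`. The registers `4` and
`5` hold `i` and `k`. -/
def fillSum (a : ℕ) (N K : NExpr) (term : CExpr) : Program :=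
  forLoop 4 N (.seq (.setCell a (.reg 4) .zero)
    (forLoop 5 K (.setCell a (.reg 4) (.add (.cell a (.reg 4)) term))))

/-- The evaluations are required in every state that agrees with `s` up to the target array and the
counters, so they stay valid while the loops run. `B` dominates `1`, `N₀` and `N₀ * K₀`, which makes
the time of the nested loops linear in `B`. -/
theorem reaches_fillSum {a : ℕ} {N K : NExpr} {term : CExpr} {s : State} {N₀ K₀ B : ℕ}
    (τ : Fin N₀ → Fin K₀ → ℂ)
    (hN : ∀ s', Frame {a} {4, 5} s s' → N.eval s' = N₀)
    (hK : ∀ s', Frame {a} {4, 5} s s' → K.eval s' = K₀)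
    (hterm : ∀ (i : Fin N₀) (k : Fin K₀) s', Frame {a} {4, 5} s s' → s'.reg 4 = i → s'.reg 5 = k →
      term.eval s' = τ i k)
    (hB : 1 ≤ B) (hNB : N₀ ≤ B) (hNKB : N₀ * K₀ ≤ B) :
    Reaches O (fillSum a N K term) s ((N.cost + K.cost + term.cost + 13) * 3 * B)
      fun s' => Frame {a} {4, 5} s s' ∧ ∀ i : Fin N₀, s'.mem a i = ∑ k, τ i k := by
  -- Extension by zero, so that partial sums can run over `Finset.range`.
  let τ' : ℕ → ℕ → ℂ := fun i k =>
    if h : i < N₀ ∧ k < K₀ then τ ⟨i, h.1⟩ ⟨k, h.2⟩ else 0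
  let I : ℕ → State → Prop := fun i s' => Frame {a} {4, 5} s s' ∧ s'.reg 4 = i ∧
    ∀ i' < i, s'.mem a i' = ∑ k ∈ Finset.range K₀, τ' i' k
  have h4 : (4 : ℕ) ∈ ({4, 5} : Finset ℕ) := by decide
  have h5 : (5 : ℕ) ∈ ({4, 5} : Finset ℕ) := by decide
  have ha : a ∈ ({a} : Finset ℕ) := Finset.mem_singleton_self a
  have main := Reaches.forLoop (O := O) (r := 4) (N := N) (I := I) (K := N₀)
    (c := 3 + (K₀ * (term.cost + 5 + K.cost + 6) + K.cost + 4))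
    (body := .seq (.setCell a (.reg 4) .zero)
      (forLoop 5 K (.setCell a (.reg 4) (.add (.cell a (.reg 4)) term))))
    (fun i s' hs' => ⟨hs'.2.1, hN s' hs'.1⟩) ?_ (s := s)
    ⟨(Frame.refl _ _ s).setReg h4 0, State.setReg_reg_self _ _ _, fun i' hi' => by omega⟩
  · refine main.mono ?_ fun s' hs' => ⟨hs'.1, fun i => ?_⟩
    · calc N₀ * (3 + (K₀ * (term.cost + 5 + K.cost + 6) + K.cost + 4) + N.cost + 6) + N.cost + 4
          = (term.cost + K.cost + 11) * (N₀ * K₀) + (K.cost + N.cost + 13) * N₀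
            + (N.cost + 4) * 1 := by ring
        _ ≤ (term.cost + K.cost + 11) * B + (K.cost + N.cost + 13) * B + (N.cost + 4) * B := by
            gcongr
        _ ≤ (N.cost + K.cost + term.cost + 13) * 3 * B := by
            rw [← add_mul, ← add_mul]
            gcongr
            omega
    · rw [hs'.2.2 i i.2, Finset.sum_range]
      exact Finset.sum_congr rfl fun k _ => dif_pos ⟨i.2, k.2⟩
  · intro i hi s₁ hs₁
    let I' : ℕ → State → Prop := fun k s' => Frame {a} {4, 5} s s' ∧ s'.reg 4 = i ∧
      s'.reg 5 = k ∧ (∀ i' < i, s'.mem a i' = ∑ k ∈ Finset.range K₀, τ' i' k) ∧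
      s'.mem a i = ∑ k' ∈ Finset.range k, τ' i k'
    refine (Reaches.seq (p := fun s' => Frame {a} {4, 5} s s' ∧ s'.reg 4 = i ∧
      (∀ i' < i, s'.mem a i' = ∑ k ∈ Finset.range K₀, τ' i' k) ∧ s'.mem a i = 0)
      (t₁ := 3) (Reaches.setCell ?_) fun s₂ hs₂ => ?_)
    · obtain ⟨hf, hr, hm⟩ := hs₁
      simp only [NExpr.eval, CExpr.eval, hr]
      exact ⟨hf.setCell ha _ _, hr, fun i' hi' => by
        rw [State.setCell_mem_of_ne _ _ _ hi'.ne, hm i' hi'], State.setCell_mem_self _ _ _ _⟩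
    · have inner := Reaches.forLoop (O := O) (r := 5) (N := K) (I := I') (K := K₀)
        (c := term.cost + 5) (body := .setCell a (.reg 4) (.add (.cell a (.reg 4)) term))
        (fun k s' hs' => ⟨hs'.2.2.1, hK s' hs'.1⟩) ?_ (s := s₂)
        ⟨hs₂.1.setReg h5 0, (State.setReg_reg_of_ne _ _ (by decide)).trans hs₂.2.1,
          State.setReg_reg_self _ _ _, hs₂.2.2.1, hs₂.2.2.2⟩
      · refine inner.mono le_rfl fun s₃ hs₃ => ⟨hs₃.2.1, hs₃.1.setReg h4 _,
          State.setReg_reg_self _ _ _, fun i' hi' => ?_⟩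
        rw [State.setReg_mem]
        rcases Nat.lt_succ_iff_lt_or_eq.1 hi' with h | rfl
        · exact hs₃.2.2.2.1 i' h
        · exact hs₃.2.2.2.2
      · intro k hk s₃ ⟨hf, hr4, hr5, hlt, hcur⟩
        refine (Reaches.setCell ?_).mono (p := fun s' => s'.reg 5 = k ∧
          I' (k + 1) (s'.setReg 5 (k + 1))) ?_ fun _ h => h
        · have hτ : term.eval s₃ = τ' i k := by
            rw [hterm ⟨i, hi⟩ ⟨k, hk⟩ s₃ hf hr4 hr5]
            simp only [τ', dif_pos (And.intro hi hk)]
          simp only [NExpr.eval, CExpr.eval, hr4, hτ, hcur]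
          refine ⟨hr5, (hf.setCell ha _ _).setReg h5 _, ?_, State.setReg_reg_self _ _ _, ?_, ?_⟩
          · exact (State.setReg_reg_of_ne _ _ (by decide)).trans hr4
          · intro i' hi'
            rw [State.setReg_mem, State.setCell_mem_of_ne _ _ _ hi'.ne, hlt i' hi']
          · rw [State.setReg_mem, State.setCell_mem_self, Finset.sum_range_succ]
        · simp only [NExpr.cost, CExpr.cost]
          omega

theorem State.writeMatrix_mem_self (s : State) (a : ℕ) {k : ℕ} (M : Matrix (Fin k) (Fin k) ℂ)
    (p q : Fin k) : (s.writeMatrix a M).mem a (p * k + q) = M p q := by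
  have hk : 0 < k := p.pos
  have hlt : (p : ℕ) * k + q < k * k :=
    calc (p : ℕ) * k + q < p * k + k := Nat.add_lt_add_left q.2 _
      _ = (p + 1) * k := by ring
      _ ≤ k * k := Nat.mul_le_mul_right _ p.2
  have hdiv : ((p : ℕ) * k + q) / k = p := by
    rw [mul_comm, Nat.mul_add_div hk, Nat.div_eq_of_lt q.2, add_zero]
  have hmod : ((p : ℕ) * k + q) % k = q := by
    rw [mul_comm, Nat.mul_add_mod, Nat.mod_eq_of_lt q.2]
  simp only [State.writeMatrix, Function.update_self, dif_pos hlt, hdiv, hmod]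

theorem State.writeMatrix_mem_of_ne (s : State) {a a' : ℕ} {k : ℕ} (M : Matrix (Fin k) (Fin k) ℂ)
    (h : a' ≠ a) : (s.writeMatrix a M).mem a' = s.mem a' := by
  simp [State.writeMatrix, h]

theorem reaches_jordan {m : NExpr} {aM aS aJ aS' : ℕ} {s : State} {k : ℕ} (hm : m.eval s = k)
    (M : Matrix (Fin k) (Fin k) ℂ) (hM : ∀ p q : Fin k, s.mem aM (p * k + q) = M p q)
    (hSJ : aS ≠ aJ) (hSS' : aS ≠ aS') (hJS' : aJ ≠ aS') :
    Reaches O (.jordan m aM aS aJ aS') s (m.cost + k * k + 1) fun s' =>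
      Frame {aS, aJ, aS'} ∅ s s' ∧ (∀ p q : Fin k, s'.mem aS (p * k + q) = O.left M p q) ∧
        (∀ p q : Fin k, s'.mem aJ (p * k + q) = O.form M p q) ∧
        ∀ p q : Fin k, s'.mem aS' (p * k + q) = O.right M p q := by
  subst hm
  refine ⟨_, _, .jordan s m aM aS aJ aS' M ?_, le_rfl, ⟨fun a ha => ?_, fun r _ => rfl⟩,
    fun p q => ?_, fun p q => ?_, fun p q => ?_⟩
  · ext p q
    exact (hM p q).symm
  · simp only [Finset.mem_insert, Finset.mem_singleton, not_or] at ha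
    rw [State.writeMatrix_mem_of_ne _ _ ha.2.2, State.writeMatrix_mem_of_ne _ _ ha.2.1,
      State.writeMatrix_mem_of_ne _ _ ha.1]
  · rw [State.writeMatrix_mem_of_ne _ _ hSS', State.writeMatrix_mem_of_ne _ _ hSJ,
      State.writeMatrix_mem_self]
  · rw [State.writeMatrix_mem_of_ne _ _ hJS', State.writeMatrix_mem_self]
  · rw [State.writeMatrix_mem_self]

end Machine

/-! ### Substitution in a Jordan form, and the test for positive semidefiniteness. -/

section Subroutines

open Matrix ComplexOrder

variable {O : JordanSubroutine}

theorem Frame.mem_eq {A R : Finset ℕ} {s s' : State} (h : Frame A R s s') {a : ℕ} (ha : a ∉ A)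
    (k : ℕ) : s'.mem a k = s.mem a k :=
  congrFun (h.1 a ha) k

/-- Solve `z = z J + y` for a Jordan form `J` in array `4` and a row vector `y` in array `7`, with
`z = 0` in the blocks whose eigenvalue has absolute value at least one. The component `q` of `z`
is stored in the cell `q + 1` of array `8`. -/
def solveProgram : Program :=
  -- Cell `0` of array `8` is a sentinel: the shift by one lets component `0` use a predecessor
  -- equal to `0`. Its coefficient is then read at the truncated index `0 - 1 = 0`, which is
  -- harmless.
  .seq (.setCell 8 (.const 0) .zero) <| forLoop 4 (.reg 3) <|
    .branch
      -- `|λ| ≥ 1` is tested without square roots, as `1 ≤ λ λ^*`.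
      (.reLE .one (.mul (.cell 4 (.add (.mul (.reg 4) (.reg 3)) (.reg 4)))
        (.conj (.cell 4 (.add (.mul (.reg 4) (.reg 3)) (.reg 4))))))
      (.setCell 8 (.add (.reg 4) (.const 1)) .zero)
      (.setCell 8 (.add (.reg 4) (.const 1))
        (.div
          (.add (.cell 7 (.reg 4)) (.mul (.cell 8 (.reg 4))
            (.cell 4 (.add (.mul (.sub (.reg 4) (.const 1)) (.reg 3)) (.reg 4)))))
          (.sub .one (.cell 4 (.add (.mul (.reg 4) (.reg 3)) (.reg 4))))))

/-- Outside the deleted blocks, `z_q (1 - J_qq) = y_q + z_{q-1} J_{q-1,q}` with nonzero factor `1 -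
J_qq`. So the given solution `z` is determined from left to right, and the program must reproduce
it. -/
theorem reaches_solveProgram {s : State} {m B : ℕ} {J : Matrix (Fin m) (Fin m) ℂ}
    {y z : Fin m → ℂ} (hm : s.reg 3 = m) (hJ : IsJordanForm J)
    (hJmem : ∀ p q : Fin m, s.mem 4 (p * m + q) = J p q) (hy : ∀ p : Fin m, s.mem 7 p = y p)
    (hz : z = z ᵥ* J + y) (hz0 : ∀ p, 1 ≤ ‖J p p‖ → z p = 0) (hB : 1 ≤ B) (hmB : m ≤ B) :
    Reaches O solveProgram s (58 * B) fun s' =>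
      Frame {8} {4} s s' ∧ ∀ p : Fin m, s'.mem 8 (p + 1) = z p := by
  let I : ℕ → State → Prop := fun k s' => Frame {8} {4} s s' ∧ s'.reg 4 = k ∧ s'.mem 8 0 = 0 ∧
    ∀ p : Fin m, (p : ℕ) < k → s'.mem 8 (p + 1) = z p
  have h4 : (4 : ℕ) ∈ ({4} : Finset ℕ) := by decide
  have h8 : (8 : ℕ) ∈ ({8} : Finset ℕ) := by decide
  have hstep : ∀ (k : ℕ) (hk : k < m) (s' : State), I k s' → ∀ w, w = z ⟨k, hk⟩ →
      (s'.setCell 8 (k + 1) w).reg 4 = k ∧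
        I (k + 1) ((s'.setCell 8 (k + 1) w).setReg 4 (k + 1)) := by
    rintro k hk s' ⟨hf, hr, h0, hlt⟩ w rfl
    refine ⟨hr, (hf.setCell h8 _ _).setReg h4 _, State.setReg_reg_self _ _ _, ?_, fun p hp => ?_⟩
    · rw [State.setReg_mem, State.setCell_mem_of_ne _ _ _ (by omega), h0]
    · rw [State.setReg_mem]
      rcases Nat.lt_succ_iff_lt_or_eq.1 hp with h | h
      · rw [State.setCell_mem_of_ne _ _ _ (by omega), hlt p h]
      · obtain rfl : p = ⟨k, hk⟩ := Fin.ext h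
        exact State.setCell_mem_self _ _ _ _
  refine (Reaches.seq (p := fun s' => Frame {8} {4} s s' ∧ s'.mem 8 0 = 0)
    (Reaches.setCell ⟨(Frame.refl _ _ s).setCell h8 _ _, State.setCell_mem_self _ _ _ _⟩)
    fun s₁ hs₁ => Reaches.forLoop (I := I) (K := m) (c := 43) (fun k s' hs' => ⟨hs'.2.1, ?_⟩)
      ?_ ⟨hs₁.1.setReg h4 0, State.setReg_reg_self _ _ _, hs₁.2,
        fun p hp => absurd hp (Nat.not_lt_zero _)⟩).mono ?_
      fun s' hs' => ⟨hs'.1, fun p => hs'.2.2.2 p p.2⟩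
  · exact (hs'.1.2 3 (by decide)).trans hm
  · intro k hk s' hs'
    have hdiag : s'.mem 4 (k * m + k) = J ⟨k, hk⟩ ⟨k, hk⟩ :=
      (hs'.1.mem_eq (by decide) _).trans (hJmem ⟨k, hk⟩ ⟨k, hk⟩)
    have hr3 : s'.reg 3 = m := (hs'.1.2 3 (by decide)).trans hm
    have hiff : (Test.reLE .one (.mul (.cell 4 (.add (.mul (.reg 4) (.reg 3)) (.reg 4)))
        (.conj (.cell 4 (.add (.mul (.reg 4) (.reg 3)) (.reg 4)))))).Holds s' ↔
        1 ≤ ‖J ⟨k, hk⟩ ⟨k, hk⟩‖ := by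
      simp only [Test.Holds, CExpr.eval, NExpr.eval, hs'.2.1, hr3, hdiag, RCLike.star_def,
        Complex.mul_conj, Complex.ofReal_re, Complex.one_re, Complex.normSq_eq_norm_sq]
      rw [one_le_sq_iff₀ (norm_nonneg _)]
    refine (Reaches.branch (t := 27) (fun hc => ?_) (fun hc => ?_)).mono le_rfl fun _ h => h
    · refine (Reaches.setCell ?_).mono (p := fun s'' => s''.reg 4 = k ∧
        I (k + 1) (s''.setReg 4 (k + 1))) (by decide) fun _ h => h
      simp only [NExpr.eval, CExpr.eval, hs'.2.1]
      exact hstep k hk s' hs' 0 (hz0 _ (hiff.1 hc)).symm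
    · refine (Reaches.setCell ?_).mono (p := fun s'' => s''.reg 4 = k ∧
        I (k + 1) (s''.setReg 4 (k + 1))) (by decide) fun _ h => h
      simp only [NExpr.eval, CExpr.eval, hs'.2.1, hr3]
      refine hstep k hk s' hs' _ ?_
      rw [hiff, not_le] at hc
      have hne : 1 - J ⟨k, hk⟩ ⟨k, hk⟩ ≠ 0 := by
        intro h
        rw [← sub_eq_zero.1 h, norm_one] at hc
        exact lt_irrefl _ hc
      rw [hdiag, div_eq_iff hne, show s'.mem 7 k = y ⟨k, hk⟩ from
        (hs'.1.mem_eq (by decide) _).trans (hy ⟨k, hk⟩)]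
      have hzk := congrFun hz ⟨k, hk⟩
      rw [Pi.add_apply] at hzk
      rcases k with _ | k
      · rw [hJ.vecMul_zero z rfl] at hzk
        rw [hs'.2.2.1]
        linear_combination -hzk
      · have hJk : s'.mem 4 ((k + 1 - 1) * m + (k + 1)) = J ⟨k, by omega⟩ ⟨k + 1, hk⟩ :=
          (hs'.1.mem_eq (by decide) _).trans (hJmem ⟨k, by omega⟩ ⟨k + 1, hk⟩)
        rw [hJ.vecMul_succ z (p := ⟨k, by omega⟩) rfl] at hzk
        rw [hJk, hs'.2.2.2 ⟨k, by omega⟩ (Nat.lt_succ_self k)]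
        linear_combination -hzk
  · simp only [NExpr.cost, CExpr.cost]
    omega

/-- Set register `0` to `1` if all diagonal entries of the matrix in array `13` have nonnegative
real parts, and to `0` otherwise. -/
def checkProgram : Program :=
  .seq (.setReg 0 (.const 1)) <| forLoop 4 (.reg 1) <|
    .branch (.reLE .zero (.cell 13 (.add (.mul (.reg 4) (.reg 1)) (.reg 4))))
      .skip (.setReg 0 (.const 0))

theorem reaches_checkProgram {s : State} {d B : ℕ} {J : Matrix (Fin d) (Fin d) ℂ}
    (hd : s.reg 1 = d) (hJ : ∀ p q : Fin d, s.mem 13 (p * d + q) = J p q) (hB : 1 ≤ B)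
    (hdB : d ≤ B) :
    Reaches O checkProgram s (24 * B) fun s' =>
      ((∀ p, 0 ≤ (J p p).re) → s'.reg 0 = 1) ∧ (¬ (∀ p, 0 ≤ (J p p).re) → s'.reg 0 = 0) := by
  classical
  let I : ℕ → State → Prop := fun k s' => s'.reg 4 = k ∧ s'.reg 1 = d ∧ s'.mem = s.mem ∧
    s'.reg 0 = if ∀ p : Fin d, (p : ℕ) < k → 0 ≤ (J p p).re then 1 else 0
  refine (Reaches.seq (p := fun s' => s'.reg 1 = d ∧ s'.mem = s.mem ∧ s'.reg 0 = 1)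
    (Reaches.setReg ⟨(State.setReg_reg_of_ne _ _ (by decide)).trans hd, rfl,
      State.setReg_reg_self _ _ _⟩)
    fun s₁ hs₁ => Reaches.forLoop (N := .reg 1) (I := I) (K := d) (c := 10)
      (fun k s' hs' => ⟨hs'.1, hs'.2.1⟩)
      ?_ ⟨State.setReg_reg_self _ _ _, (State.setReg_reg_of_ne _ _ (by decide)).trans hs₁.1,
        hs₁.2.1, ?_⟩).mono ?_ fun s' hs' => ?_
  · rintro k hk s' ⟨hr4, hr1, hmem, hr0⟩
    have hiff : (Test.reLE .zero (.cell 13 (.add (.mul (.reg 4) (.reg 1)) (.reg 4)))).Holds s' ↔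
        0 ≤ (J ⟨k, hk⟩ ⟨k, hk⟩).re := by
      simp only [Test.Holds, CExpr.eval, NExpr.eval, hr4, hr1, hmem, ← hJ, Complex.zero_re]
    have hsucc : (∀ p : Fin d, (p : ℕ) < k + 1 → 0 ≤ (J p p).re) ↔
        (∀ p : Fin d, (p : ℕ) < k → 0 ≤ (J p p).re) ∧ 0 ≤ (J ⟨k, hk⟩ ⟨k, hk⟩).re := by
      refine ⟨fun h => ⟨fun p hp => h p (by omega), h ⟨k, hk⟩ (Nat.lt_succ_self k)⟩,
        fun h p hp => ?_⟩
      rcases Nat.lt_succ_iff_lt_or_eq.1 hp with hp | hp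
      · exact h.1 p hp
      · obtain rfl : p = ⟨k, hk⟩ := Fin.ext hp
        exact h.2
    refine (Reaches.branch (t := 2) (fun hc => ?_) (fun hc => ?_)).mono le_rfl fun _ h => h
    · refine (Reaches.skip ⟨hr4, State.setReg_reg_self _ _ _,
        (State.setReg_reg_of_ne _ _ (by decide)).trans hr1, hmem, ?_⟩).mono (by decide)
          fun _ h => h
      rw [State.setReg_reg_of_ne _ _ (by decide), hr0]
      simp only [hsucc, hiff.1 hc, and_true]
    · refine (Reaches.setReg (q := fun s' => s'.reg 4 = k ∧ I (k + 1) (s'.setReg 4 (k + 1)))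
        ⟨(State.setReg_reg_of_ne _ _ (by decide)).trans hr4, State.setReg_reg_self _ _ _,
        (State.setReg_reg_of_ne _ _ (by decide)).trans
          ((State.setReg_reg_of_ne _ _ (by decide)).trans hr1), hmem, ?_⟩).mono (by decide)
          fun _ h => h
      rw [State.setReg_reg_of_ne _ _ (by decide), State.setReg_reg_self, if_neg]
      · rfl
      · exact fun h => hc (hiff.2 (hsucc.1 h).2)
  · rw [State.setReg_reg_of_ne _ _ (by decide), hs₁.2.2, if_pos]
    exact fun p hp => absurd hp (Nat.not_lt_zero _)
  · simp only [NExpr.cost]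
    omega
  · have hr0 := hs'.2.2.2
    simp only [Fin.is_lt, forall_const] at hr0
    exact ⟨fun h => by rw [hr0, if_pos h], fun h => by rw [hr0, if_neg h]⟩

/-- The lexicographic enumeration of pairs. -/
def pairEquiv (d : ℕ) : Fin d × Fin d ≃ Fin (d * d) := finProdFinEquiv

theorem pairEquiv_val {d : ℕ} (r : Fin d × Fin d) : (pairEquiv d r : ℕ) = pairIndex r := by
  simp only [pairEquiv, finProdFinEquiv_apply_val, pairIndex]
  ring

/-- The lexicographic enumeration of triples. -/
def tripleEquiv (n d : ℕ) : Fin n × Fin d × Fin d ≃ Fin (n * (d * d)) :=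
  (Equiv.prodCongr (Equiv.refl _) (pairEquiv d)).trans finProdFinEquiv

theorem tripleEquiv_val {n d : ℕ} (r : Fin n × Fin d × Fin d) :
    (tripleEquiv n d r : ℕ) = tripleIndex r := by
  simp only [tripleEquiv, Equiv.trans_apply, Equiv.prodCongr_apply, Prod.map, Equiv.refl_apply,
    finProdFinEquiv_apply_val, pairEquiv_val, tripleIndex]
  ring

/-- Decide whether the Hermitian `d × d` matrix with entries `gap` is positive semidefinite. -/
def psdProgram (gap : CExpr) : Program :=
  -- Sums with one term: this just writes the entries of the matrix to array `11`.
  .seq (fillSum 11 (.mul (.reg 1) (.reg 1)) (.const 1) gap) <|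
    .seq (.jordan (.reg 1) 11 12 13 14) checkProgram

theorem reaches_psdProgram {gap : CExpr} {s : State} {d B : ℕ} {D : Matrix (Fin d) (Fin d) ℂ}
    (hd : s.reg 1 = d) (hD : D.IsHermitian)
    (hgap : ∀ r s', Frame {11} {4, 5} s s' → s'.reg 4 = pairIndex r → gap.eval s' = D r.1 r.2)
    (hB : 1 ≤ B) (hdB : d ≤ B) (hddB : d * d ≤ B) :
    Reaches O (psdProgram gap) s ((gap.cost * 3 + 78) * B) fun s' =>
      (D.PosSemidef → s'.reg 0 = 1) ∧ (¬ D.PosSemidef → s'.reg 0 = 0) := by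
  refine (Reaches.seq (reaches_fillSum (N₀ := d * d) (K₀ := 1) (B := B)
    (fun u _ => D ((pairEquiv d).symm u).1 ((pairEquiv d).symm u).2) (fun s' hf => ?_)
    (fun s' _ => rfl) (fun u _ s' hf h4 _ => ?_) hB hddB (by rwa [mul_one])) fun s₁ hs₁ =>
    Reaches.seq (reaches_jordan (k := d) ?_ D (fun p q => ?_) (by decide) (by decide) (by decide))
    fun s₂ hs₂ => reaches_checkProgram (B := B) ?_ hs₂.2.2.1 hB hdB).mono ?_ fun s' hs' => ?_
  · simp only [NExpr.eval, (hf.2 1 (by decide)).trans hd]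
  · refine hgap _ s' hf ?_
    rw [h4, ← pairEquiv_val, Equiv.apply_symm_apply]
  · exact (hs₁.1.2 1 (by decide)).trans hd
  · have := hs₁.2 (pairEquiv d (p, q))
    rwa [pairEquiv_val, Finset.univ_unique, Finset.sum_singleton, Equiv.symm_apply_apply] at this
  · exact (hs₂.1.2 1 (by decide)).trans ((hs₁.1.2 1 (by decide)).trans hd)
  · simp only [NExpr.cost]
    calc _ = (gap.cost * 3 + 51) * B + (d * d + 2 * 1 + 24 * B) := by ring
      _ ≤ (gap.cost * 3 + 51) * B + (B + 2 * B + 24 * B) := by gcongr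
      _ = (gap.cost * 3 + 78) * B := by ring
  · rw [(O.spec D (exists_jordanDecomp D)).posSemidef_iff hD]
    exact hs'

end Subroutines

/-! ### The decision algorithm and its running time. -/

section Algorithm

open Matrix ComplexOrder

variable {O : JordanSubroutine}

/-- The primitive works on indices in `Fin m`, the fixed point formula on triples. -/
theorem IsJordanDecomp.reindex {ι : Type*} [Fintype ι] [DecidableEq ι] {m : ℕ} (e : ι ≃ Fin m)
    {A : Matrix ι ι ℂ} {S J S' : Matrix (Fin m) (Fin m) ℂ}
    (h : IsJordanDecomp (A.submatrix e.symm e.symm) S J S') :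
    IsJordanDecomp A (S.submatrix e id) J (S'.submatrix id e) where
  mul_inv := by
    rw [← Matrix.submatrix_mul _ _ _ _ _ Function.bijective_id, h.mul_inv,
      Matrix.submatrix_one_equiv]
  inv_mul := by
    rw [← Matrix.submatrix_mul _ _ _ _ _ e.bijective, h.inv_mul, Matrix.submatrix_id_id]
  jordan := h.jordan
  eq := by
    have : A = (A.submatrix e.symm e.symm).submatrix e e := by simp
    rw [this, h.eq]
    rfl

/-- Sum the rows `(a, a)` of the matrix in array `1`, with `m` columns. -/
def sumDiagRowsProgram : Program :=
  fillSum 6 (.reg 3) (.reg 1)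
    (.cell 1 (.add (.mul (.add (.mul (.reg 5) (.reg 1)) (.reg 5)) (.reg 3)) (.reg 4)))

theorem reaches_sumDiagRowsProgram {s : State} {d m B : ℕ} (g : Fin d → Fin m → ℂ)
    (hd : s.reg 1 = d) (hm : s.reg 3 = m)
    (hg : ∀ (a : Fin d) (p : Fin m), s.mem 1 ((a * d + a) * m + p) = g a p)
    (hB : 1 ≤ B) (hmB : m ≤ B) (hmdB : m * d ≤ B) :
    Reaches O sumDiagRowsProgram s (75 * B) fun s' =>
      Frame {6} {4, 5} s s' ∧ ∀ p : Fin m, s'.mem 6 p = ∑ a, g a p := by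
  refine reaches_fillSum (N := .reg 3) (K := .reg 1) (fun p a => g a p)
    (fun s' hf => (hf.2 3 (by decide)).trans hm)
    (fun s' hf => (hf.2 1 (by decide)).trans hd) (fun p a s' hf h4 h5 => ?_) hB hmB hmdB
  simp only [CExpr.eval, NExpr.eval, h4, h5, (hf.2 1 (by decide)).trans hd,
    (hf.2 3 (by decide)).trans hm]
  exact (hf.mem_eq (by decide) _).trans (hg a p)

/-- Multiply the row vector in array `6` by the `m × m` matrix in array `3`. -/
def mulLeftProgram : Program :=
  fillSum 7 (.reg 3) (.reg 3)
    (.mul (.cell 6 (.reg 5)) (.cell 3 (.add (.mul (.reg 5) (.reg 3)) (.reg 4))))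

theorem reaches_mulLeftProgram {s : State} {m B : ℕ} (x : Fin m → ℂ)
    (S : Matrix (Fin m) (Fin m) ℂ) (hm : s.reg 3 = m) (hx : ∀ p : Fin m, s.mem 6 p = x p)
    (hS : ∀ p q : Fin m, s.mem 3 (p * m + q) = S p q)
    (hB : 1 ≤ B) (hmB : m ≤ B) (hmmB : m * m ≤ B) :
    Reaches O mulLeftProgram s (72 * B) fun s' =>
      Frame {7} {4, 5} s s' ∧ ∀ q : Fin m, s'.mem 7 q = ∑ p, x p * S p q := by
  refine reaches_fillSum (N := .reg 3) (K := .reg 3) (fun q p => x p * S p q)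
    (fun s' hf => (hf.2 3 (by decide)).trans hm)
    (fun s' hf => (hf.2 3 (by decide)).trans hm) (fun q p s' hf h4 h5 => ?_) hB hmB hmmB
  simp only [CExpr.eval, NExpr.eval, h4, h5, (hf.2 3 (by decide)).trans hm]
  rw [hf.mem_eq (by decide), hf.mem_eq (by decide), hx, hS]

/-- Multiply the row vector in array `8` by the block of the columns `(i, c, c')` of the `m × m`
matrix in array `5`. -/
def mulBlockProgram : Program :=
  fillSum 9 (.mul (.reg 1) (.reg 1)) (.reg 3)
    (.mul (.cell 8 (.add (.reg 5) (.const 1)))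
      (.cell 5 (.add (.mul (.reg 5) (.reg 3))
        (.add (.mul (.reg 2) (.mul (.reg 1) (.reg 1))) (.reg 4)))))

theorem reaches_mulBlockProgram {s : State} {d m i B : ℕ} (z : Fin m → ℂ)
    (S' : Fin m → Fin (d * d) → ℂ) (hd : s.reg 1 = d) (hi : s.reg 2 = i) (hm : s.reg 3 = m)
    (hz : ∀ p : Fin m, s.mem 8 (p + 1) = z p)
    (hS' : ∀ (p : Fin m) (u : Fin (d * d)), s.mem 5 (p * m + (i * (d * d) + u)) = S' p u)
    (hB : 1 ≤ B) (hddB : d * d ≤ B) (hddmB : d * d * m ≤ B) :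
    Reaches O mulBlockProgram s (102 * B) fun s' =>
      Frame {9} {4, 5} s s' ∧ ∀ u : Fin (d * d), s'.mem 9 u = ∑ p, z p * S' p u := by
  refine reaches_fillSum (N := .mul (.reg 1) (.reg 1)) (K := .reg 3) (fun u p => z p * S' p u)
    (fun s' hf => ?_)
    (fun s' hf => (hf.2 3 (by decide)).trans hm) (fun u p s' hf h4 h5 => ?_) hB hddB hddmB
  · simp only [NExpr.eval, (hf.2 1 (by decide)).trans hd]
  · simp only [CExpr.eval, NExpr.eval, h4, h5, (hf.2 1 (by decide)).trans hd,
      (hf.2 2 (by decide)).trans hi, (hf.2 3 (by decide)).trans hm]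
    rw [hf.mem_eq (by decide), hf.mem_eq (by decide), hz, hS']

/-- Sum the rows `(a, a)` of the `d² × d²` matrix in array `2`. -/
def sumDiagSquareProgram : Program :=
  fillSum 10 (.mul (.reg 1) (.reg 1)) (.reg 1)
    (.cell 2 (.add (.mul (.add (.mul (.reg 5) (.reg 1)) (.reg 5)) (.mul (.reg 1) (.reg 1)))
      (.reg 4)))

theorem reaches_sumDiagSquareProgram {s : State} {d B : ℕ} (g : Fin d → Fin (d * d) → ℂ)
    (hd : s.reg 1 = d)
    (hg : ∀ (a : Fin d) (u : Fin (d * d)), s.mem 2 ((a * d + a) * (d * d) + u) = g a u)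
    (hB : 1 ≤ B) (hddB : d * d ≤ B) (hdddB : d * d * d ≤ B) :
    Reaches O sumDiagSquareProgram s (87 * B) fun s' =>
      Frame {10} {4, 5} s s' ∧ ∀ u : Fin (d * d), s'.mem 10 u = ∑ a, g a u := by
  refine reaches_fillSum (N := .mul (.reg 1) (.reg 1)) (K := .reg 1) (fun u a => g a u)
    (fun s' hf => ?_)
    (fun s' hf => (hf.2 1 (by decide)).trans hd) (fun u a s' hf h4 h5 => ?_) hB hddB hdddB
  · simp only [NExpr.eval, (hf.2 1 (by decide)).trans hd]
  · simp only [CExpr.eval, NExpr.eval, h4, h5, (hf.2 1 (by decide)).trans hd]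
    exact (hf.mem_eq (by decide) _).trans (hg a u)

/-- Compute the rows `tr F_i (|c⟩⟨c'|)` and `tr E (|c⟩⟨c'|)` in the arrays `9` and `10`. -/
def traceProgram : Program :=
  .seq (.setReg 3 (.mul (.reg 0) (.mul (.reg 1) (.reg 1)))) <|
  .seq (.jordan (.reg 3) 0 3 4 5) <|
  .seq sumDiagRowsProgram <|
  .seq mulLeftProgram <|
  .seq solveProgram <|
  .seq mulBlockProgram sumDiagSquareProgram

variable {H : Type*} [NormedAddCommGroup H] [InnerProductSpace ℂ H] [FiniteDimensional ℂ H]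
  {n d : ℕ} {b : OrthonormalBasis (Fin d) ℂ H} {T : Matrix (Fin n) (Fin n) (OpMap H)}
  {G F : Fin n → OpMap H} {E : OpMap H} {i : Fin n}

/-- With `f` and `g` the trace rows of `M_F` and `M_G`, the vector `z = f S` solves `z = z J + g S`
and vanishes on the deleted blocks. The program finds `z` from `g S` and then recovers block `i` of
`f = z S⁻¹`. -/
theorem reaches_traceProgram (hsys : IsSystem T G) (hF : IsLeastFixedPoint T G F) {s : State}
    (hs : IsInput b T G E i s) (hd : 0 < d) :
    Reaches O traceProgram s (403 * (n * (d * d) * (n * (d * d)))) fun s' =>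
      s'.reg 1 = d ∧ ∀ r, s'.mem 9 (pairIndex r) = traceRow b (F i) r ∧
        s'.mem 10 (pairIndex r) = traceRow b E r := by
  have hn : 0 < n := i.pos
  have hmemT := hs.mem_T
  have hmemG := hs.mem_G
  obtain ⟨m, hm⟩ : ∃ m, m = n * (d * d) := ⟨_, rfl⟩
  let e : Fin n × Fin d × Fin d ≃ Fin m := (tripleEquiv n d).trans (finCongr hm.symm)
  have he : ∀ r, (e r : ℕ) = tripleIndex r := tripleEquiv_val
  have hesymm : ∀ p : Fin m, tripleIndex (e.symm p) = p := fun p => by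
    rw [← he, Equiv.apply_symm_apply]
  rw [← hm] at hmemT hmemG ⊢
  have hdd : d ≤ d * d := Nat.le_mul_self d
  have hddm : d * d ≤ m := hm ▸ Nat.le_mul_of_pos_left _ hn
  have hm1 : 1 ≤ m := hd.trans_le (hdd.trans hddm)
  have hmm : m ≤ m * m := Nat.le_mul_self m
  have hB : 1 ≤ m * m := hm1.trans hmm
  let M := (matrixRepSquare b T).submatrix e.symm e.symm
  have hdec := (O.spec M (exists_jordanDecomp M)).reindex e
  let f : Fin n × Fin d × Fin d → ℂ := diagRow d ᵥ* matrixRepRow b F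
  let g : Fin n × Fin d × Fin d → ℂ := diagRow d ᵥ* matrixRepRow b G
  obtain ⟨hz, hz0⟩ := hF.row_spec hsys b hdec (diagRow d)
  have hg : ∀ p : Fin m, ∑ a, matrixRepRow b G (a, a) (e.symm p) = g (e.symm p) := fun p =>
    (sum_diagRow_mul fun r => matrixRepRow b G r (e.symm p)).symm
  have hy : ∀ q, ∑ p, g (e.symm p) * O.left M p q = (g ᵥ* (O.left M).submatrix e id) q := fun q =>
    (Fintype.sum_equiv e _ _ fun r => by simp).symm
  have hw : ∀ r, ∑ p, (f ᵥ* (O.left M).submatrix e id) p * O.right M p (e r) = f r := fun r => by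
    change ((f ᵥ* (O.left M).submatrix e id) ᵥ* (O.right M).submatrix id e) r = f r
    rw [Matrix.vecMul_vecMul, hdec.mul_inv, Matrix.vecMul_one]
  let s₁ := s.setReg 3 m
  have hr₁ : Run O (.setReg 3 (.mul (.reg 0) (.mul (.reg 1) (.reg 1)))) s s₁ 6 := by
    have := Run.setReg (O := O) s 3 (.mul (.reg 0) (.mul (.reg 1) (.reg 1)))
    simp only [NExpr.eval, hs.reg_n, hs.reg_d, ← hm] at this
    exact this
  obtain ⟨s₂, t₂, hr₂, ht₂, hf₂, hS₂, hJ₂, hS'₂⟩ := reaches_jordan (O := O) (m := .reg 3) (aM := 0)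
    (aS := 3) (aJ := 4) (aS' := 5) (s := s₁) (k := m) (State.setReg_reg_self _ _ _) M
    (fun p q => by
      have := hmemT (e.symm p) (e.symm q)
      rwa [hesymm, hesymm] at this) (by decide) (by decide) (by decide)
  have hf₁ : Frame {3, 4, 5} {3} s s₂ :=
    ⟨hf₂.1, fun r hr => (hf₂.2 r (Finset.notMem_empty r)).trans
      (State.setReg_reg_of_ne s m (Finset.notMem_singleton.1 hr))⟩
  have h1₂ : s₂.reg 1 = d := (hf₁.2 1 (by decide)).trans hs.reg_d
  have h2₂ : s₂.reg 2 = i := (hf₁.2 2 (by decide)).trans hs.reg_i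
  have h3₂ : s₂.reg 3 = m :=
    (hf₂.2 3 (Finset.notMem_empty 3)).trans (State.setReg_reg_self _ _ _)
  obtain ⟨s₃, t₃, hr₃, ht₃, hf₃, h₃⟩ := reaches_sumDiagRowsProgram (O := O) (B := m * m)
    (fun a p => matrixRepRow b G (a, a) (e.symm p)) h1₂ h3₂ (fun a p => by
      rw [hf₁.mem_eq (by decide), ← hmemG (a, a) (e.symm p), hesymm]
      rfl) hB hmm (Nat.mul_le_mul_left _ (hdd.trans hddm))
  have h3₃ : s₃.reg 3 = m := (hf₃.2 3 (by decide)).trans h3₂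
  obtain ⟨s₄, t₄, hr₄, ht₄, hf₄, h₄⟩ := reaches_mulLeftProgram (O := O) (B := m * m)
    (fun p => g (e.symm p)) (O.left M) h3₃ (fun p => (h₃ p).trans (hg p))
    (fun p q => (hf₃.mem_eq (by decide) _).trans (hS₂ p q)) hB hmm le_rfl
  have h3₄ : s₄.reg 3 = m := (hf₄.2 3 (by decide)).trans h3₃
  obtain ⟨s₅, t₅, hr₅, ht₅, hf₅, h₅⟩ := reaches_solveProgram (O := O) (B := m * m) h3₄ hdec.jordan
    (fun p q => (hf₄.mem_eq (by decide) _).trans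
      ((hf₃.mem_eq (by decide) _).trans (hJ₂ p q)))
    (fun q => (h₄ q).trans (hy q)) hz hz0 hB hmm
  have h3₅ : s₅.reg 3 = m := (hf₅.2 3 (by decide)).trans h3₄
  have h1₅ : s₅.reg 1 = d := (hf₅.2 1 (by decide)).trans
    ((hf₄.2 1 (by decide)).trans ((hf₃.2 1 (by decide)).trans h1₂))
  have h2₅ : s₅.reg 2 = i := (hf₅.2 2 (by decide)).trans
    ((hf₄.2 2 (by decide)).trans ((hf₃.2 2 (by decide)).trans h2₂))
  obtain ⟨s₆, t₆, hr₆, ht₆, hf₆, h₆⟩ := reaches_mulBlockProgram (O := O) (B := m * m)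
    (f ᵥ* (O.left M).submatrix e id)
    (fun p u => O.right M p (e (i, (pairEquiv d).symm u))) h1₅ h2₅ h3₅ h₅ (fun p u => by
      rw [hf₅.mem_eq (by decide), hf₄.mem_eq (by decide), hf₃.mem_eq (by decide), ← hS'₂, he,
        tripleIndex, ← pairEquiv_val, Equiv.apply_symm_apply])
    hB (hddm.trans hmm) (Nat.mul_le_mul_right _ hddm)
  have h1₆ : s₆.reg 1 = d := (hf₆.2 1 (by decide)).trans h1₅
  obtain ⟨s₇, t₇, hr₇, ht₇, hf₇, h₇⟩ := reaches_sumDiagSquareProgram (O := O) (B := m * m)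
    (fun a u => matrixRep b E (a, a) ((pairEquiv d).symm u)) h1₆ (fun a u => by
      rw [hf₆.mem_eq (by decide), hf₅.mem_eq (by decide), hf₄.mem_eq (by decide),
        hf₃.mem_eq (by decide), hf₁.mem_eq (by decide), ← hs.mem_E, ← pairEquiv_val,
        ← pairEquiv_val, Equiv.apply_symm_apply, pairEquiv_val]
      rfl) hB (hddm.trans hmm) (Nat.mul_le_mul hddm (hdd.trans hddm))
  refine ⟨s₇, _, .seq hr₁ (.seq hr₂ (.seq hr₃ (.seq hr₄ (.seq hr₅ (.seq hr₆ hr₇))))), ?_,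
    (hf₇.2 1 (by decide)).trans h1₆, fun r => ⟨?_, ?_⟩⟩
  -- `403 = 75 + 72 + 58 + 102 + 87 + 1 + 8`: the five subroutines, the `m²` units of the primitive,
  -- and `8` further units absorbed by `1 ≤ m * m`.
  · simp only [NExpr.cost] at ht₂
    generalize m * m = B at *
    omega
  · rw [hf₇.mem_eq (by decide), ← pairEquiv_val, h₆, Equiv.symm_apply_apply, hw]
    exact diagRow_vecMul_matrixRepRow b F (i, r)
  · rw [← pairEquiv_val, h₇, Equiv.symm_apply_apply, traceRow_eq_sum]

/-- Compute the trace rows and test the matrix with entries `gap` for positivity. -/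
def comparisonProgram (gap : CExpr) : Program :=
  .seq traceProgram (psdProgram gap)

theorem decides_comparisonProgram (hsys : IsSystem T G) (hF : IsLeastFixedPoint T G F) {s : State}
    (hs : IsInput b T G E i s) (hd : 0 < d) {gap : CExpr} {D : Matrix (Fin d) (Fin d) ℂ}
    (hD : D.IsHermitian) (hcost : gap.cost = 5)
    (hgap : ∀ (r : Fin d × Fin d) s', s'.mem 9 (pairIndex r) = traceRow b (F i) r →
      s'.mem 10 (pairIndex r) = traceRow b E r → s'.reg 4 = pairIndex r →
      gap.eval s' = D r.1 r.2) {A : Prop} (hA : A ↔ D.PosSemidef) :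
    Decides O (comparisonProgram gap) s (496 * (n ^ 2 * d ^ 4)) A := by
  obtain ⟨s₁, t₁, hr₁, ht₁, hreg, hrow⟩ := reaches_traceProgram (O := O) hsys hF hs hd
  have hdd : d ≤ d * d := Nat.le_mul_self d
  have hddm : d * d ≤ n * (d * d) := Nat.le_mul_of_pos_left _ i.pos
  have hmm : n * (d * d) ≤ n * (d * d) * (n * (d * d)) := Nat.le_mul_self _
  obtain ⟨s₂, t₂, hr₂, ht₂, hyes, hno⟩ := reaches_psdProgram (O := O) (gap := gap)
    (B := n * (d * d) * (n * (d * d))) hreg hD (fun r s' hf h4 => hgap r s'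
      ((hf.mem_eq (by decide) _).trans (hrow r).1) ((hf.mem_eq (by decide) _).trans (hrow r).2) h4)
    (by omega) (by omega) (by omega)
  refine ⟨s₂, _, .seq hr₁ hr₂, ?_, fun h => hyes (hA.1 h), fun h => hno fun h' => h (hA.2 h')⟩
  rw [hcost] at ht₂
  -- `496 = 403 + (5 * 3 + 78)`.
  calc t₁ + t₂ ≤ 496 * (n * (d * d) * (n * (d * d))) := by omega
    _ = 496 * (n ^ 2 * d ^ 4) := by ring

end Algorithm

end

end QMC

open QMC in
theorem theorem1 :
    -- the least fixed point exists, and its matrix representation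
    (∀ (H : Type*) [NormedAddCommGroup H] [InnerProductSpace ℂ H] [FiniteDimensional ℂ H]
        [Nontrivial H] (n : ℕ) (T : Matrix (Fin n) (Fin n) (OpMap H)) (G : Fin n → OpMap H),
      IsSystem T G →
      ∃ F : Fin n → OpMap H, IsLeastFixedPoint T G F ∧
        ∀ (d : ℕ) (b : OrthonormalBasis (Fin d) ℂ H) (m : ℕ)
          (S : Matrix (Fin n × Fin d × Fin d) (Fin m) ℂ) (J : Matrix (Fin m) (Fin m) ℂ)
          (S' : Matrix (Fin m) (Fin n × Fin d × Fin d) ℂ),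
          IsJordanDecomp (matrixRepSquare b T) S J S' →
          IsUnit (1 - S * truncate J * S') ∧
            matrixRepRow b F = matrixRepRow b G * (1 - S * truncate J * S')⁻¹) ∧
    -- both relations are decided in time `O(n² d⁴)`
    (∃ (P Q : Program) (C : ℕ),
      ∀ (H : Type*) [NormedAddCommGroup H] [InnerProductSpace ℂ H] [FiniteDimensional ℂ H]
        [Nontrivial H] (n d : ℕ) (b : OrthonormalBasis (Fin d) ℂ H)
        (T : Matrix (Fin n) (Fin n) (OpMap H)) (G F : Fin n → OpMap H),
      IsSystem T G → IsLeastFixedPoint T G F →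
      ∀ (E : OpMap H), IsSubOp E → ∀ (i : Fin n) (O : JordanSubroutine) (s : State),
        IsInput b T G E i s →
          Decides O P s (C * (n ^ 2 * d ^ 4)) (TraceLE E (F i)) ∧
          Decides O Q s (C * (n ^ 2 * d ^ 4)) (TraceLE (F i) E)) := by
  refine ⟨fun H _ _ _ _ n T G h => ?_,
    comparisonProgram (.sub (.cell 9 (.reg 4)) (.cell 10 (.reg 4))),
    comparisonProgram (.sub (.cell 10 (.reg 4)) (.cell 9 (.reg 4))), 496, ?_⟩
  · obtain ⟨F, hF, -⟩ := h.exists_leastFixedPoint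
    exact ⟨F, hF, fun d b m S J S' hd => hF.matrixRepRow_eq h b hd⟩
  · intro H _ _ _ _ n d b T G F h hF E hE i O s hs
    -- `H` is nontrivial, so its basis is nonempty. Positivity of `d` lets additive constants be
    -- absorbed into `n ^ 2 * d ^ 4`.
    have hd : 0 < d := by
      obtain ⟨c⟩ := b.toBasis.index_nonempty
      exact c.pos
    refine ⟨decides_comparisonProgram h hF hs hd (traceGap_isHermitian b hE.1 (hF.mem i).1) rfl
      (fun r s' h9 h10 h4 => ?_) (traceLE_iff_posSemidef b hE.1 (hF.mem i).1),
      decides_comparisonProgram h hF hs hd (traceGap_isHermitian b (hF.mem i).1 hE.1) rfl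
      (fun r s' h9 h10 h4 => ?_) (traceLE_iff_posSemidef b (hF.mem i).1 hE.1)⟩
    all_goals simp only [CExpr.eval, NExpr.eval, h4, h9, h10, traceGap]
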